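/- Let $F$ be a non-archimedean local field of characteristic zero, with residue field of cardinality $q$ and normalized absolute value $|\cdot|$ (so $|\pi|=q^{-1}$ for a uniformizer $\pi$). Let $\mathsf X$ be an algebraic variety over $F$ (a separated, reduced scheme of finite type over $F$) with an action of a connected linear algebraic group $\mathsf G$ over $F$ (a connected group scheme over $F$ whose underlying scheme is affine, reduced and of finite type). Give $\mathsf X(F)$ and $\mathsf G(F)$ their natural topologies. Let $\nu:\mathsf G\to\mathbb G_m$ be an algebraic character over $F$, and let $f$ be a $\nu$-invariant regular function on $\mathsf X$, i.e. $f(g\cdot x)=\nu(g)f(x)$ for all $g\in\mathsf G(\overline F)$, $x\in\mathsf X(\overline F)$. Put $V(f)=\{x\in\mathsf X(F): f(x)=0\}$ and $U=\mathsf X(F)\setminus V(f)$. Let $\chi:\mathsf G(F)\to\mathbb C^\times$ be a homomorphism that is continuous for the discrete topology on $\mathbb C^\times$. For a locally compact, totally disconnected Hausdorff space $Y$, let $\mathcal S(Y)$ be the space of locally constant compactly supported functions $Y\to\mathbb C$; a distribution on $Y$ is a linear functional on $\mathcal S(Y)$. If $\mathsf G(F)$ acts on $Y$ continuously, put $(g\cdot\phi)(x)=\phi(g^{-1}x)$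 and call a distribution $\xi$ $\chi$-invariant if $\xi(g\cdot\phi)=\chi(g)\xi(\phi)$ for all $g\in\mathsf G(F)$, $\phi\in\mathcal S(Y)$. A $\mathsf G(F)$-orbit $O\subset\mathsf X(F)$ is called $\chi$-admissible if there is a nonzero $\chi$-invariant distribution on $O$. Let $\mu$ be a $\chi$-invariant distribution on $U$. Assume that the zeta integral $$Z_{f,\mu}(\phi)(s)=\int_U\phi(x)\,|f(x)|^s\,d\mu,\qquad \phi\in\mathcal S(\mathsf X(F)),$$ is standard at $s=0$, that is: 1. $\mu$ is a complex measure on $U$ (i.e. $d\mu=h\,dm$ with $m$ a positive locally finite Borel measure on $U$ and $h$ measurable, $|h|=1$); 2. for every $\phi\in\mathcal S(\mathsf X(F))$ the integral converges absolutely for $\operatorname{Re}(s)$ sufficiently large and has a meromorphic continuation to the whole complex plane; 3. there is $n_0\in\mathbb N$ such that $s^{n_0}Z_{f,\mu}(\phi)$ is analytic at $s=0$ for every $\phi\in\mathcal S(\mathsf X(F))$. If $Z_{f,\mu}$ has a pole at $s=0$, i.e. the meromorphic continuation of $Z_{f,\mu}(\phi)$ has a pole at $s=0$ for some $\phi\in\mathcal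 S(\mathsf X(F))$, then $V(f)$ contains at least one $\chi$-admissible orbit. -/

import Mathlib

open CategoryTheory AlgebraicGeometry
open scoped NNReal LaurentPolynomial ValuativeRel

attribute [local instance] CategoryTheory.Hom.monoid CategoryTheory.Hom.group

universe u

noncomputable section

/-! ### Distributions on `ℓ`-spaces -/

/-- Schwartz functions on a (Hausdorff) space `Y`: locally constant complex valued functions with
compact support. -/
def SchwartzFun (Y : Type*) [TopologicalSpace Y] : Submodule ℂ (Y → ℂ) where
  carrier := {φ | IsLocallyConstant φ ∧ HasCompactSupport φ}
  add_mem' := fun ha hb => ⟨ha.1.add hb.1, ha.2.add hb.2⟩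
  zero_mem' := ⟨IsLocallyConstant.const 0, HasCompactSupport.zero⟩
  smul_mem' := fun c _ h => ⟨h.1.comp (fun z => c • z), h.2.smul_left (f := fun _ => c)⟩

/-- Distributions on `Y`: all linear functionals on the space of Schwartz functions. -/
abbrev LDistribution (Y : Type*) [TopologicalSpace Y] : Type _ := SchwartzFun Y →ₗ[ℂ] ℂ

/-- The left translate `(g • φ)(x) = φ (g⁻¹ • x)` of a Schwartz function. -/
def SchwartzFun.translate {Γ Y : Type*} [Group Γ] [MulAction Γ Y] [TopologicalSpace Y]
    [ContinuousConstSMul Γ Y] (g : Γ) (φ : SchwartzFun Y) : SchwartzFun Y :=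
  ⟨fun x => (φ : Y → ℂ) (g⁻¹ • x),
    φ.2.1.comp_continuous (continuous_const_smul g⁻¹),
    φ.2.2.comp_homeomorph (Homeomorph.smul g⁻¹)⟩

/-- A distribution `ξ` is `χ`-invariant if `ξ (g • φ) = χ g * ξ φ` for all `g` and `φ`. -/
def IsSemiInvariant {Γ Y : Type*} [Group Γ] [MulAction Γ Y] [TopologicalSpace Y]
    [ContinuousConstSMul Γ Y] (χ : Γ →* ℂˣ) (ξ : LDistribution Y) : Prop :=
  ∀ (g : Γ) (φ : SchwartzFun Y), ξ (SchwartzFun.translate g φ) = (χ g : ℂ) * ξ φ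

/-- The character `χ` is admissible on a homogeneous space `Y` (or `Y` is `χ`-admissible) if there
is a nonzero `χ`-invariant distribution on `Y`. -/
def IsAdmissible {Γ : Type*} [Group Γ] (χ : Γ →* ℂˣ) (Y : Type*) [MulAction Γ Y]
    [TopologicalSpace Y] [ContinuousConstSMul Γ Y] : Prop :=
  ∃ ξ : LDistribution Y, ξ ≠ 0 ∧ IsSemiInvariant χ ξ

instance SubMulAction.instContinuousConstSMul' {Γ T : Type*} [Group Γ] [MulAction Γ T]
    [TopologicalSpace T] [ContinuousConstSMul Γ T] (S : SubMulAction Γ T) :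
    ContinuousConstSMul Γ S :=
  ⟨fun g => ((continuous_const_smul g).comp continuous_subtype_val).subtype_mk _⟩

instance MulAction.orbit.instContinuousConstSMul' {Γ T : Type*} [Group Γ] [MulAction Γ T]
    [TopologicalSpace T] [ContinuousConstSMul Γ T] (x : T) :
    ContinuousConstSMul Γ (MulAction.orbit Γ x) :=
  ⟨fun g => ((continuous_const_smul g).comp continuous_subtype_val).subtype_mk _⟩

/-- The distribution `μ` is the complex (Radon) measure `h dm`, where `m` is a positive locally
finite Borel measure (the total variation of `μ`) and `h` is a measurable phase, `|h| = 1`. -/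
structure IsPolarDecomposition {Y : Type*} [TopologicalSpace Y] [MeasurableSpace Y] [BorelSpace Y]
    (μ : LDistribution Y) (m : MeasureTheory.Measure Y) (h : Y → ℂ) : Prop where
  isLocallyFinite : MeasureTheory.IsLocallyFiniteMeasure m
  measurable : Measurable h
  norm_eq_one : ∀ y, ‖h y‖ = 1
  apply_eq : ∀ φ : SchwartzFun Y, μ φ = ∫ y, (φ : Y → ℂ) y * h y ∂m

/-! ### Varieties over a local field and their points -/

section Varieties

theorem top_le_preimage_top {A B : Scheme.{u}} (b : A ⟶ B) : (⊤ : A.Opens) ≤ b ⁻¹ᵁ ⊤ :=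
  le_refl (⊤ : A.Opens)

variable (F : Type u) [Field F]

/-- `K`-points, over `F`, of an `F`-scheme, for a field extension `K` of `F`. -/
abbrev Points (K : Type u) [Field K] [Algebra F K] (Y : Over (Spec (.of F))) : Type u :=
  Over.mk (Spec.map (CommRingCat.ofHom (algebraMap F K))) ⟶ Y

/-- `F`-rational points. -/
abbrev RatPoints (Y : Over (Spec (.of F))) : Type u := Points F F Y

variable {F}

/-- The value at a `K`-point `x` of a function regular on an open subscheme containing `x`. -/
def evalOn {K : Type u} [Field K] [Algebra F K] {Y : Over (Spec (.of F))} (x : Points F K Y)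
    (U : Y.left.Opens) (hU : ⊤ ≤ x.left ⁻¹ᵁ U) (φ : Γ(Y.left, U)) : K :=
  (Scheme.ΓSpecIso (.of K)).hom (x.left.appLE U ⊤ hU φ)

/-- The value of a regular function at a `K`-point. -/
def evalPt {K : Type u} [Field K] [Algebra F K] {Y : Over (Spec (.of F))} (x : Points F K Y)
    (f : Γ(Y.left, ⊤)) : K :=
  evalOn x ⊤ (top_le_preimage_top x.left) f

/-- The natural topology on the set of rational points of a variety over a topological field `F`:
the coarsest one for which `U(F)` is open and regular functions `U(F) → F` are continuous, for all
Zariski open `U`. -/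
instance RatPoints.instTopologicalSpace [TopologicalSpace F] (Y : Over (Spec (.of F))) :
    TopologicalSpace (RatPoints F Y) :=
  TopologicalSpace.generateFrom
    {S | ∃ (U : Y.left.Opens) (φ : Γ(Y.left, U)) (W : Set F), IsOpen W ∧
      S = {x : RatPoints F Y | ∃ hU : ⊤ ≤ x.left ⁻¹ᵁ U, evalOn x U hU φ ∈ W}}

instance RatPoints.instMeasurableSpace [TopologicalSpace F] (Y : Over (Spec (.of F))) :
    MeasurableSpace (RatPoints F Y) := borel _

instance RatPoints.instBorelSpace [TopologicalSpace F] (Y : Over (Spec (.of F))) :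
    BorelSpace (RatPoints F Y) := ⟨rfl⟩

/-- Morphisms of varieties induce continuous maps on rational points. -/
theorem RatPoints.continuous_comp [TopologicalSpace F] {X Y : Over (Spec (.of F))} (a : X ⟶ Y) :
    Continuous (fun x : RatPoints F X => (x ≫ a : RatPoints F Y)) := by
  refine continuous_generateFrom_iff.2 ?_
  rintro _ ⟨U, φ, W, hW, rfl⟩
  refine TopologicalSpace.isOpen_generateFrom_of_mem
    ⟨a.left ⁻¹ᵁ U, a.left.app U φ, W, hW, ?_⟩
  ext x
  have key : ∀ hU : ⊤ ≤ (x ≫ a).left ⁻¹ᵁ U,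
      evalOn (x ≫ a : RatPoints F Y) U hU φ
        = evalOn x (a.left ⁻¹ᵁ U) hU (a.left.app U φ) := by
    intro hU
    have h1 : (x.left ≫ a.left).appLE U ⊤ hU = a.left.app U ≫ x.left.appLE _ ⊤ hU :=
      Scheme.Hom.comp_appLE _ _ _ _ _
    exact congrArg (fun t => (Scheme.ΓSpecIso (.of F)).hom t)
      (congrArg (fun t => t.hom φ) h1)
  constructor
  · rintro ⟨hU, h⟩
    exact ⟨hU, (key hU) ▸ h⟩
  · rintro ⟨hU, h⟩
    exact ⟨hU, (key hU).symm ▸ h⟩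

/-- A rational point acts on the rational points by homeomorphisms. -/
instance RatPoints.instContinuousConstSMul [TopologicalSpace F] (G X : Over (Spec (.of F)))
    [GrpObj G] [ModObj G X] : ContinuousConstSMul (RatPoints F G) (RatPoints F X) := by
  refine ⟨fun g => ?_⟩
  have hid : Spec.map (CommRingCat.ofHom (algebraMap F F)) = 𝟙 (Spec (.of F)) := Spec.map_id _
  let s : X ⟶ Over.mk (Spec.map (CommRingCat.ofHom (algebraMap F F))) :=
    Over.homMk X.hom (by simp)
  have hs : ∀ x : RatPoints F X, x ≫ s = 𝟙 _ := fun x => by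
    ext1
    have hw : x.left ≫ X.hom = Spec.map (CommRingCat.ofHom (algebraMap F F)) := Over.w x
    exact hw.trans hid
  have h : (fun x : RatPoints F X => g • x)
      = fun x => x ≫ ((s ≫ g) • (𝟙 X : X ⟶ X)) := by
    funext x
    rw [ModObj.comp_smul, ← Category.assoc, hs, Category.id_comp, Category.comp_id]
  rw [h]
  exact RatPoints.continuous_comp _

variable (F) in
/-- The split multiplicative group `𝔾ₘ = Spec F[T, T⁻¹]` over `F`, as a group scheme. -/
abbrev multGroup : Over (Spec (.of F)) :=
  (Spec (.of F[T;T⁻¹])).asOver (Spec (.of F))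

/-- The value `ν(g) ∈ K` of an algebraic character `ν : G ⟶ 𝔾ₘ` at a `K`-point `g` of `G`: the
coordinate `T` of the point `ν(g)` of `𝔾ₘ`. -/
def charVal {K : Type u} [Field K] [Algebra F K] {G : Over (Spec (.of F))}
    (ν : G ⟶ multGroup F) (g : Points F K G) : K :=
  evalPt (g ≫ ν : Points F K (multGroup F))
    ((Scheme.ΓSpecIso (.of F[T;T⁻¹])).inv (LaurentPolynomial.T 1 : F[T;T⁻¹]))

/-- A regular function `f` on `X` is `ν`-invariant if `f(g • x) = ν(g) f(x)` for all points `g` of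
`G` and `x` of `X` over the algebraic closure of `F`. -/
def IsInvariantFunction {G X : Over (Spec (.of F))} [GrpObj G] [ModObj G X]
    (ν : G ⟶ multGroup F) (f : Γ(X.left, ⊤)) : Prop :=
  ∀ (g : Points F (AlgebraicClosure F) G) (x : Points F (AlgebraicClosure F) X),
    evalPt (g • x) f = charVal ν g * evalPt x f

end Varieties

/-! ### The zero locus of an invariant function and its complement -/

section Locus

variable {F : Type u} [Field F]

theorem appLE_comp_top {A B C : Scheme.{u}} (b : A ⟶ B) (x : B ⟶ C)
    (h : (⊤ : A.Opens) ≤ (b ≫ x) ⁻¹ᵁ ⊤) (h' : (⊤ : B.Opens) ≤ x ⁻¹ᵁ ⊤) :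
    (b ≫ x).appLE ⊤ ⊤ h = x.appLE ⊤ ⊤ h' ≫ b.appTop := by
  have e : b.appTop = b.appLE ⊤ ⊤ (top_le_preimage_top b) := Scheme.Hom.app_eq_appLE b
  rw [e, Scheme.Hom.appLE_comp_appLE]

theorem evalPt_comp {Y : Over (Spec (.of F))} {K : Type u} [Field K] [Algebra F K]
    (b : Over.mk (Spec.map (CommRingCat.ofHom (algebraMap F K))) ⟶
      Over.mk (Spec.map (CommRingCat.ofHom (algebraMap F F))))
    (hb : b.left = Spec.map (CommRingCat.ofHom (algebraMap F K)))
    (x : RatPoints F Y) (f : Γ(Y.left, ⊤)) :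
    evalPt (b ≫ x : Points F K Y) f = algebraMap F K (evalPt x f) := by
  have h1 : (b.left ≫ x.left).appLE ⊤ ⊤ (top_le_preimage_top _) =
      x.left.appLE ⊤ ⊤ (top_le_preimage_top _) ≫ b.left.appTop :=
    appLE_comp_top b.left x.left _ _
  have h2 : (Spec.map (CommRingCat.ofHom (algebraMap F K))).appTop ≫ (Scheme.ΓSpecIso (.of K)).hom
      = (Scheme.ΓSpecIso (.of F)).hom ≫ CommRingCat.ofHom (algebraMap F K) :=
    Scheme.ΓSpecIso_naturality _
  have h3 : (b.left ≫ x.left).appLE ⊤ ⊤ (top_le_preimage_top _) ≫ (Scheme.ΓSpecIso (.of K)).hom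
      = (x.left.appLE ⊤ ⊤ (top_le_preimage_top _) ≫ (Scheme.ΓSpecIso (.of F)).hom) ≫
        CommRingCat.ofHom (algebraMap F K) := by
    rw [h1, hb, Category.assoc, Category.assoc]
    exact congrArg _ h2
  exact congrArg (fun t => t.hom f) h3

theorem charVal_ne_zero {K : Type u} [Field K] [Algebra F K] {G : Over (Spec (.of F))}
    (ν : G ⟶ multGroup F) (g : Points F K G) : charVal ν g ≠ 0 := by
  let e : F[T;T⁻¹] →+* K := ((Scheme.ΓSpecIso (.of F[T;T⁻¹])).inv ≫
    Scheme.Hom.appLE (g ≫ ν).left ⊤ ⊤ (top_le_preimage_top _) ≫ (Scheme.ΓSpecIso (.of K)).hom).hom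
  have h : IsUnit (e (LaurentPolynomial.T 1)) := (LaurentPolynomial.isUnit_T 1).map e
  exact h.ne_zero

/-- The complement `U` of the zero set of a `ν`-invariant regular function `f` on `X(F)`, as a
`G(F)`-stable subset. -/
def nonvanishingLocus {G X : Over (Spec (.of F))} [GrpObj G] [ModObj G X]
    {ν : G ⟶ multGroup F} {f : Γ(X.left, ⊤)} (hf : IsInvariantFunction ν f) :
    SubMulAction (RatPoints F G) (RatPoints F X) where
  carrier := {x | evalPt x f ≠ 0}
  smul_mem' := by
    intro g x hx
    let b : Over.mk (Spec.map (CommRingCat.ofHom (algebraMap F (AlgebraicClosure F)))) ⟶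
      Over.mk (Spec.map (CommRingCat.ofHom (algebraMap F F))) :=
        Over.homMk (Spec.map (CommRingCat.ofHom (algebraMap F (AlgebraicClosure F)))) (by simp)
    have h := hf (b ≫ g) (b ≫ x)
    rw [← ModObj.comp_smul, evalPt_comp b rfl, evalPt_comp b rfl] at h
    have hx' : algebraMap F (AlgebraicClosure F) (evalPt x f) ≠ 0 :=
      (map_ne_zero _).2 hx
    have h0 := mul_ne_zero (charVal_ne_zero ν (b ≫ g)) hx'
    rw [← h] at h0
    exact (map_ne_zero _).1 h0

end Locus

/-! ### Zeta integrals -/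

section Zeta

variable {F : Type u} [Field F] [ValuativeRel F] [TopologicalSpace F] [IsNonarchimedeanLocalField F]

/-- The normalized absolute value of a non-archimedean local field: a uniformizer has absolute
value `q⁻¹`, where `q` is the cardinality of the residue field. -/
def normalizedAbs (x : F) : ℝ :=
  WithZeroMulInt.toNNReal (e := (Nat.card 𝓀[F] : ℝ≥0)) (Nat.cast_ne_zero.2 Nat.card_pos.ne')
    (IsNonarchimedeanLocalField.valueGroupWithZeroIsoInt F (ValuativeRel.valuation F x))

variable {G X : Over (Spec (.of F))} [GrpObj G] [ModObj G X]
  {ν : G ⟶ multGroup F} {f : Γ(X.left, ⊤)} {hf : IsInvariantFunction ν f}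

/-- `M` is a meromorphic continuation to the complex plane of the zeta integral
`Z_{f,μ}(φ)(s) = ∫_U φ(x) |f(x)|^s dμ`, which converges absolutely for `Re s` large; here
`μ = h dm` is a complex measure. -/
def IsZetaContinuation (μ : LDistribution (nonvanishingLocus hf))
    (φ : SchwartzFun (RatPoints F X)) (M : ℂ → ℂ) : Prop :=
  Meromorphic M ∧
  ∃ (m : MeasureTheory.Measure (nonvanishingLocus hf)) (h : nonvanishingLocus hf → ℂ),
    IsPolarDecomposition μ m h ∧
    ∃ σ : ℝ, ∀ s : ℂ, σ < s.re →
      MeasureTheory.Integrable (fun x : nonvanishingLocus hf =>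
        (φ : RatPoints F X → ℂ) x * (normalizedAbs (evalPt x.1 f) : ℂ) ^ s * h x) m ∧
      M s = ∫ x : nonvanishingLocus hf,
        (φ : RatPoints F X → ℂ) x * (normalizedAbs (evalPt x.1 f) : ℂ) ^ s * h x ∂m

/-- The zeta integral `Z_{f,μ}` is standard at `s₀`. -/
structure IsStandardAt (μ : LDistribution (nonvanishingLocus hf)) (s₀ : ℂ) : Prop where
  isComplexMeasure : ∃ m h, IsPolarDecomposition μ m h
  exists_continuation : ∀ φ : SchwartzFun (RatPoints F X), ∃ M, IsZetaContinuation μ φ M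
  bounded_order : ∃ n₀ : ℕ, ∀ (φ : SchwartzFun (RatPoints F X)) (M : ℂ → ℂ),
    IsZetaContinuation μ φ M → ((-(n₀ : ℤ) : ℤ) : WithTop ℤ) ≤ meromorphicOrderAt M s₀

/-- The zeta integral `Z_{f,μ}` has a pole at `s₀`: the continuation of `Z_{f,μ}(φ)` has a pole
at `s₀` for some Schwartz function `φ`. -/
def HasPoleAt (μ : LDistribution (nonvanishingLocus hf)) (s₀ : ℂ) : Prop :=
  ∃ (φ : SchwartzFun (RatPoints F X)) (M : ℂ → ℂ),
    IsZetaContinuation μ φ M ∧ meromorphicOrderAt M s₀ < 0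

end Zeta

end

/-! The leading Laurent coefficient of the zeta integral at `s = 0` is an invariant distribution
living on `V(f)`. A change of variables gives `Z(g • φ)(s) = χ(g) |ν(g)|^s Z(φ)(s)`, first for `Re
s` large and then by continuation. Since the pole orders are bounded, there is a least `N` such that
`s^N Z(φ)(s)` has a limit `ξ(φ)` at `0` for every `φ`. The pole forces `N > 0`, minimality makes `ξ`
nonzero, and `ξ` is `χ`-invariant because `|ν(g)|^s → 1`. If `φ` is supported in `U`, then `|f|`
takes finitely many values on its support, so `Z(φ)` is entire and `ξ(φ) = 0`. This is
`IsRegularization.exists_isSemiInvariant`.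

It remains to find an admissible orbit in the support of `ξ`, which is
`IsSemiInvariant.exists_isAdmissible_orbit`. When the orbit space is Hausdorff, this is the
localization principle: if no orbit is admissible, then near each orbit every `φ` is a combination
of functions `g • ψ - χ(g) ψ`, and a clopen partition of the orbit space gives `ξ(φ) = 0`. In
general the orbit space is not Hausdorff. However, if every orbit is locally closed at one of its
points, two applications of Baire's theorem yield a nonempty relatively open piece of the support on
which orbit equivalence is realized by a compact set of group elements, hence is a closed relation.
The saturation of that piece has a Hausdorff orbit space, and `ξ` restricts to it without vanishing.

Orbits are locally closed somewhere because an orbit is the image of `G(F)` under a morphism. By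
`exists_isClosed_inter_eq_iUnion_range`, a suitable part of such an image has irreducible Zariski
closure and is dominated by an irreducible variety whose rational points are dense. In
characteristic zero this dominant map is generically smooth, and the implicit function theorem over
`F` shows that the image contains a nonempty open set of rational points of the closure. -/

noncomputable section

section

open Topology Set

/-! ### Spaces with a basis of compact open sets -/

section LSpaces

variable {Y : Type*} [TopologicalSpace Y]

/-- For Hausdorff spaces, `PrespectralSpace` (the compact open sets form a basis) expresses "locally
compact and totally disconnected". -/
theorem IsCompact.exists_isCompact_isOpen_between [PrespectralSpace Y] {K W : Set Y}
    (hK : IsCompact K) (hW : IsOpen W) (hKW : K ⊆ W) :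
    ∃ V, IsOpen V ∧ IsCompact V ∧ K ⊆ V ∧ V ⊆ W := by
  refine hK.induction_on (p := fun K => ∃ V, IsOpen V ∧ IsCompact V ∧ K ⊆ V ∧ V ⊆ W)
    ⟨∅, isOpen_empty, isCompact_empty, subset_rfl, empty_subset _⟩ ?_ ?_ ?_
  · rintro s t hst ⟨V, h1, h2, h3, h4⟩
    exact ⟨V, h1, h2, hst.trans h3, h4⟩
  · rintro s t ⟨V, h1, h2, h3, h4⟩ ⟨V', h1', h2', h3', h4'⟩
    exact ⟨V ∪ V', h1.union h1', h2.union h2', union_subset_union h3 h3', union_subset h4 h4'⟩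
  · intro x hx
    obtain ⟨V, ⟨h1, h2⟩, h3, h4⟩ :=
      PrespectralSpace.isTopologicalBasis.exists_subset_of_mem_open (hKW hx) hW
    exact ⟨V, mem_nhdsWithin_of_mem_nhds (h1.mem_nhds h3), V, h1, h2, subset_rfl, h4⟩

theorem IsLocallyClosed.prespectralSpace [PrespectralSpace Y] {s : Set Y}
    (hs : IsLocallyClosed s) : PrespectralSpace s := by
  obtain ⟨U, Z, hU, hZ, rfl⟩ := hs
  have : PrespectralSpace U := hU.isOpenEmbedding_subtypeVal.prespectralSpace
  let j : ↥(U ∩ Z) → U := fun x => ⟨x.1, x.2.1⟩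
  refine PrespectralSpace.of_isClosedEmbedding j ⟨⟨?_, ?_⟩, ?_⟩
  · exact IsInducing.of_comp (g := fun x : U => x.1) (by fun_prop) continuous_subtype_val
      (IsInducing.subtypeVal (t := U ∩ Z))
  · intro x y hxy
    exact Subtype.ext (congrArg (fun z : U => z.1) hxy)
  · have : range j = (fun x : U => x.1) ⁻¹' Z := by
      ext x
      exact ⟨fun ⟨y, hy⟩ => hy ▸ y.2.2, fun hx => ⟨⟨x.1, x.2, hx⟩, rfl⟩⟩
    rw [this]
    exact hZ.preimage continuous_subtype_val

/-- An additive property of clopen sets which holds for all small clopen sets holds for all clopen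
subsets of some clopen neighbourhood of any compact set. -/
theorem IsCompact.exists_isClopen_forall_subset {P : Set Y → Prop} {K : Set Y} (hK : IsCompact K)
    (h0 : P ∅)
    (hadd : ∀ V W, IsClopen V → IsClopen W → Disjoint V W → P V → P W → P (V ∪ W))
    (hloc : ∀ x ∈ K, ∃ V, IsClopen V ∧ x ∈ V ∧ ∀ W, IsClopen W → W ⊆ V → P W) :
    ∃ V, IsClopen V ∧ K ⊆ V ∧ ∀ W, IsClopen W → W ⊆ V → P W := by
  refine hK.induction_on
    (p := fun K => ∃ V, IsClopen V ∧ K ⊆ V ∧ ∀ W, IsClopen W → W ⊆ V → P W)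
    ⟨∅, isClopen_empty, subset_rfl, fun W _ hW => by rwa [subset_empty_iff.1 hW]⟩ ?_ ?_ ?_
  · rintro s t hst ⟨V, h1, h2, h3⟩
    exact ⟨V, h1, hst.trans h2, h3⟩
  · rintro s t ⟨V, h1, h2, h3⟩ ⟨V', h1', h2', h3'⟩
    refine ⟨V ∪ V', h1.union h1', union_subset_union h2 h2', fun W hW hWV => ?_⟩
    rw [← inter_union_sdiff W V]
    -- `W` is cut into `W ∩ V` and `W \ V`, so additivity over disjoint unions suffices.
    refine hadd _ _ (hW.inter h1) (hW.diff h1) ?_ (h3 _ (hW.inter h1) inter_subset_right)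
      (h3' _ (hW.diff h1) ?_)
    · exact disjoint_left.2 fun x hx hx' => hx'.2 hx.2
    · rintro x ⟨hx, hx'⟩
      exact (hWV hx).resolve_left hx'
  · intro x hx
    obtain ⟨V, h1, h2, h3⟩ := hloc x hx
    exact ⟨V, mem_nhdsWithin_of_mem_nhds (h1.isOpen.mem_nhds h2), V, h1, subset_rfl, h3⟩

end LSpaces

/-! ### Schwartz functions -/

namespace SchwartzFun

variable {Y : Type*} [TopologicalSpace Y]

theorem isClopen_support (φ : SchwartzFun Y) : IsClopen (Function.support (φ : Y → ℂ)) :=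
  (φ.2.1.isClopen_fiber 0).compl

theorem tsupport_eq (φ : SchwartzFun Y) :
    tsupport (φ : Y → ℂ) = Function.support (φ : Y → ℂ) :=
  (isClopen_support φ).isClosed.closure_eq

theorem isCompact_support (φ : SchwartzFun Y) : IsCompact (Function.support (φ : Y → ℂ)) := by
  rw [← tsupport_eq]
  exact φ.2.2

theorem finite_range (φ : SchwartzFun Y) : (range (φ : Y → ℂ)).Finite := by
  have : CompactSpace (Function.support (φ : Y → ℂ)) :=
    isCompact_iff_compactSpace.1 (isCompact_support φ)
  have h := (φ.2.1.comp_continuous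
    (continuous_subtype_val (p := fun x => x ∈ Function.support (φ : Y → ℂ)))).range_finite
  refine (h.insert 0).subset ?_
  rintro _ ⟨y, rfl⟩
  by_cases hy : (φ : Y → ℂ) y = 0
  · exact Or.inl hy
  · exact Or.inr ⟨⟨y, hy⟩, rfl⟩

/-- Multiplication of Schwartz functions by the indicator function of a clopen set. -/
def restr (V : Set Y) (hV : IsClopen V) : SchwartzFun Y →ₗ[ℂ] SchwartzFun Y where
  toFun φ := ⟨V.indicator (φ : Y → ℂ), by
    refine (IsLocallyConstant.iff_eventually_eq _).2 fun x => ?_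
    by_cases hx : x ∈ V
    · filter_upwards [φ.2.1.eventually_eq x, hV.isOpen.mem_nhds hx] with y hy hyV
      simp [hx, hyV, hy]
    · filter_upwards [hV.compl.isOpen.mem_nhds hx] with y hyV
      rw [indicator_of_notMem hx, indicator_of_notMem hyV], by
    refine HasCompactSupport.mono φ.2.2 ?_
    rw [Set.support_indicator]
    exact inter_subset_right⟩
  map_add' φ ψ := Subtype.ext (Set.indicator_add V _ _)
  map_smul' c φ := Subtype.ext (Set.indicator_const_smul V c _)

theorem restr_apply_of_mem {V : Set Y} (hV : IsClopen V) (φ : SchwartzFun Y) {x : Y} (hx : x ∈ V) :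
    (restr V hV φ : Y → ℂ) x = (φ : Y → ℂ) x :=
  indicator_of_mem hx _

theorem restr_apply_of_notMem {V : Set Y} (hV : IsClopen V) (φ : SchwartzFun Y) {x : Y}
    (hx : x ∉ V) : (restr V hV φ : Y → ℂ) x = 0 :=
  indicator_of_notMem hx _

theorem restr_eq_self {V : Set Y} (hV : IsClopen V) (φ : SchwartzFun Y)
    (h : ∀ x ∉ V, (φ : Y → ℂ) x = 0) : restr V hV φ = φ := by
  refine Subtype.ext (funext fun x => ?_)
  by_cases hx : x ∈ V
  · exact restr_apply_of_mem hV φ hx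
  · rw [restr_apply_of_notMem hV φ hx, h x hx]

theorem restr_union {V W : Set Y} (hV : IsClopen V) (hW : IsClopen W) (h : Disjoint V W)
    (φ : SchwartzFun Y) :
    restr (V ∪ W) (hV.union hW) φ = restr V hV φ + restr W hW φ :=
  Subtype.ext (Set.indicator_union_of_disjoint h _)

/-- The characteristic function of a compact open set. -/
def char (V : Set Y) (hV : IsClopen V) (hc : IsCompact V) : SchwartzFun Y :=
  ⟨V.indicator (fun _ => 1), by
    refine (IsLocallyConstant.iff_eventually_eq _).2 fun x => ?_
    by_cases hx : x ∈ V
    · filter_upwards [hV.isOpen.mem_nhds hx] with y hyV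
      simp [hx, hyV]
    · filter_upwards [hV.compl.isOpen.mem_nhds hx] with y hyV
      rw [indicator_of_notMem hx, indicator_of_notMem hyV], by
    refine hc.of_isClosed_subset (isClosed_tsupport _) (closure_minimal ?_ hV.isClosed)
    exact Set.support_indicator_subset⟩

/-- The pull back of Schwartz functions along a closed embedding. -/
def comap {Z : Type*} [TopologicalSpace Z] (ι : Z → Y) (hι : IsClosedEmbedding ι) :
    SchwartzFun Y →ₗ[ℂ] SchwartzFun Z where
  toFun φ := ⟨fun z => (φ : Y → ℂ) (ι z), φ.2.1.comp_continuous hι.continuous,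
    φ.2.2.comp_isClosedEmbedding hι⟩
  map_add' _ _ := rfl
  map_smul' _ _ := rfl

@[simp]
theorem comap_apply {Z : Type*} [TopologicalSpace Z] (ι : Z → Y) (hι : IsClosedEmbedding ι)
    (φ : SchwartzFun Y) (z : Z) : (comap ι hι φ : Z → ℂ) z = (φ : Y → ℂ) (ι z) := rfl

/-- Schwartz functions extend along embeddings, with support in any given neighbourhood. -/
theorem exists_extension [T2Space Y] [PrespectralSpace Y] {Z : Type*} [TopologicalSpace Z]
    {ι : Z → Y} (hι : IsEmbedding ι) (ψ : SchwartzFun Z) {W : Set Y} (hW : IsOpen W)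
    (h : ∀ z, (ψ : Z → ℂ) z ≠ 0 → ι z ∈ W) :
    ∃ φ : SchwartzFun Y, (∀ z, (φ : Y → ℂ) (ι z) = (ψ : Z → ℂ) z) ∧
      ∀ y ∉ W, (φ : Y → ℂ) y = 0 := by
  have key : ∀ c : ℂ, ∃ φ : SchwartzFun Y,
      (∀ z, (φ : Y → ℂ) (ι z) = if (ψ : Z → ℂ) z = c then c else 0) ∧
      ∀ y ∉ W, (φ : Y → ℂ) y = 0 := by
    -- One level set of `ψ` at a time. For `c ≠ 0` the fibre is compact open in `Z`, so it is the
    -- trace of an open `V'`. A compact open set inside `V' ∩ W` carries the extension.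
    intro c
    by_cases hc : c = 0
    · exact ⟨0, fun z => by simp [hc], fun _ _ => rfl⟩
    have hK : IsClopen ((ψ : Z → ℂ) ⁻¹' {c}) := ψ.2.1.isClopen_fiber c
    have hKc : IsCompact ((ψ : Z → ℂ) ⁻¹' {c}) := by
      refine (isCompact_support ψ).of_isClosed_subset hK.isClosed fun z hz => ?_
      rw [mem_preimage, mem_singleton_iff] at hz
      rw [Function.mem_support, hz]
      exact hc
    obtain ⟨V', hV', hV'K⟩ := hι.isOpen_iff.1 hK.isOpen
    obtain ⟨V, h1, h2, h3, h4⟩ := (hKc.image hι.continuous).exists_isCompact_isOpen_between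
      (hV'.inter hW) (by
        rintro _ ⟨z, hz, rfl⟩
        refine ⟨by rwa [← mem_preimage, hV'K], h z ?_⟩
        rw [mem_preimage, mem_singleton_iff] at hz
        rw [hz]
        exact hc)
    refine ⟨c • char V ⟨h2.isClosed, h1⟩ h2, fun z => ?_, fun y hy => ?_⟩
    · change c * V.indicator (fun _ => 1) (ι z) = _
      by_cases hz : (ψ : Z → ℂ) z = c
      · rw [if_pos hz, indicator_of_mem (h3 ⟨z, hz, rfl⟩), mul_one]
      · rw [if_neg hz, indicator_of_notMem, mul_zero]
        intro hzV
        have : z ∈ ι ⁻¹' V' := (h4 hzV).1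
        rw [hV'K] at this
        exact hz this
    · change c * V.indicator (fun _ => 1) y = 0
      rw [indicator_of_notMem (fun hyV => hy (h4 hyV).2), mul_zero]
  choose E hE1 hE2 using key
  refine ⟨∑ c ∈ (finite_range ψ).toFinset, E c, fun z => ?_, fun y hy => ?_⟩
  · rw [Submodule.coe_sum, Finset.sum_apply]
    simp_rw [hE1]
    rw [Finset.sum_ite_eq, if_pos]
    simp
  · rw [Submodule.coe_sum, Finset.sum_apply]
    exact Finset.sum_eq_zero fun c _ => hE2 c y hy

variable {Γ : Type*} [Group Γ] [MulAction Γ Y] [ContinuousConstSMul Γ Y]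

@[simp]
theorem translate_apply (g : Γ) (φ : SchwartzFun Y) (x : Y) :
    (translate g φ : Y → ℂ) x = (φ : Y → ℂ) (g⁻¹ • x) := rfl

theorem restr_translate {V : Set Y} (hV : IsClopen V) (hinv : ∀ (g : Γ) x, g • x ∈ V ↔ x ∈ V)
    (g : Γ) (φ : SchwartzFun Y) :
    restr V hV (translate g φ) = translate g (restr V hV φ) := by
  refine Subtype.ext (funext fun x => ?_)
  by_cases hx : x ∈ V
  · rw [restr_apply_of_mem hV _ hx, translate_apply, translate_apply,
      restr_apply_of_mem hV _ ((hinv _ _).2 hx)]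
  · rw [restr_apply_of_notMem hV _ hx, translate_apply,
      restr_apply_of_notMem hV _ (fun h => hx ((hinv _ _).1 h))]

end SchwartzFun

/-! ### Supports of distributions -/

namespace LDistribution

variable {Y : Type*} [TopologicalSpace Y]

/-- The support of a distribution. -/
def supp (ξ : LDistribution Y) : Set Y :=
  {x | ∀ W, IsOpen W → x ∈ W → ∃ φ : SchwartzFun Y, (∀ y ∉ W, (φ : Y → ℂ) y = 0) ∧ ξ φ ≠ 0}

theorem isClosed_supp (ξ : LDistribution Y) : IsClosed ξ.supp := by
  rw [← isOpen_compl_iff, isOpen_iff_forall_mem_open]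
  intro x hx
  simp only [supp, mem_compl_iff, mem_ofPred_eq, not_forall] at hx
  obtain ⟨W, h1, h2, h3⟩ := hx
  exact ⟨W, fun y hy hy' => h3 (hy' W h1 hy), h1, h2⟩

variable [T2Space Y] [PrespectralSpace Y]

/-- Vanishing on the support itself is enough, with no neighbourhood required: a Schwartz function
has clopen support, so its whole compact support avoids `ξ.supp` and splits into small pieces killed
by `ξ`. -/
theorem apply_eq_zero_of_supp (ξ : LDistribution Y) (φ : SchwartzFun Y)
    (h : ∀ x ∈ ξ.supp, (φ : Y → ℂ) x = 0) : ξ φ = 0 := by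
  obtain ⟨V, hV, hKV, H⟩ := (SchwartzFun.isCompact_support φ).exists_isClopen_forall_subset
    (P := fun V => ∀ hV : IsClopen V, ξ (SchwartzFun.restr V hV φ) = 0)
    (fun hV => by
      have : SchwartzFun.restr ∅ hV φ = 0 := Subtype.ext (indicator_empty _)
      rw [this, map_zero])
    (fun V W hV hW hVW h1 h2 hVW' => by
      rw [SchwartzFun.restr_union hV hW hVW, map_add, h1, h2, add_zero])
    (fun x hx => by
      have hx' : x ∉ ξ.supp := fun h' => hx (h x h')
      simp only [supp, mem_ofPred_eq, not_forall] at hx'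
      obtain ⟨W, h1, h2, h3⟩ := hx'
      obtain ⟨V, ⟨hVo, hVc⟩, hxV, hVW⟩ :=
        PrespectralSpace.isTopologicalBasis.exists_subset_of_mem_open h2 h1
      refine ⟨V, ⟨hVc.isClosed, hVo⟩, hxV, fun V' hV' hV'V hV'' => ?_⟩
      by_contra hne
      exact h3 ⟨_, fun y hy => SchwartzFun.restr_apply_of_notMem hV'' φ
        (fun hy' => hy (hVW (hV'V hy'))), hne⟩)
  have := H V hV subset_rfl hV
  rwa [SchwartzFun.restr_eq_self hV φ (fun x hx => by
    by_contra hne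
    exact hx (hKV hne))] at this

theorem supp_nonempty {ξ : LDistribution Y} (h : ξ ≠ 0) : ξ.supp.Nonempty := by
  by_contra hne
  rw [not_nonempty_iff_eq_empty] at hne
  exact h (LinearMap.ext fun φ => apply_eq_zero_of_supp ξ φ (by simp [hne]))

end LDistribution

theorem IsSemiInvariant.smul_mem_supp {Y : Type*} [TopologicalSpace Y] {Γ : Type*} [Group Γ]
    [MulAction Γ Y] [ContinuousConstSMul Γ Y]
    {χ : Γ →* ℂˣ} {ξ : LDistribution Y} (h : IsSemiInvariant χ ξ) (g : Γ) {x : Y}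
    (hx : x ∈ ξ.supp) : g • x ∈ ξ.supp := by
  intro W hW hgx
  obtain ⟨φ, h1, h2⟩ := hx ((fun y => g • y) ⁻¹' W) (hW.preimage (continuous_const_smul g)) hgx
  refine ⟨SchwartzFun.translate g φ, fun y hy => ?_, ?_⟩
  · rw [SchwartzFun.translate_apply]
    refine h1 _ fun hy' => hy ?_
    simpa using hy'
  · rw [h]
    exact mul_ne_zero (Units.ne_zero _) h2

end

section

open Topology Set

/-! ### Twisted coinvariants and localization over the orbit space -/

section Localization

variable {Γ : Type*} [Group Γ] (χ : Γ →* ℂˣ)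

/-- The kernel of the projection of the space of Schwartz functions to its twisted coinvariants. -/
def twistedAugmentation (Y : Type*) [TopologicalSpace Y] [MulAction Γ Y] [ContinuousConstSMul Γ Y] :
    Submodule ℂ (SchwartzFun Y) :=
  Submodule.span ℂ (range fun p : Γ × SchwartzFun Y =>
    SchwartzFun.translate p.1 p.2 - (χ p.1 : ℂ) • p.2)

variable {χ} {Y : Type*} [TopologicalSpace Y] [MulAction Γ Y] [ContinuousConstSMul Γ Y]

theorem IsSemiInvariant.apply_eq_zero {ξ : LDistribution Y} (h : IsSemiInvariant χ ξ)
    {φ : SchwartzFun Y} (hφ : φ ∈ twistedAugmentation χ Y) : ξ φ = 0 := by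
  have : twistedAugmentation χ Y ≤ LinearMap.ker ξ := by
    refine Submodule.span_le.2 ?_
    rintro _ ⟨⟨g, ψ⟩, rfl⟩
    simp [h g ψ]
  exact this hφ

/-- Distributions carry no continuity condition, so any nonzero functional on the twisted
coinvariants is a nonzero semi-invariant distribution. -/
theorem twistedAugmentation_eq_top (h : ¬ IsAdmissible χ Y) : twistedAugmentation χ Y = ⊤ := by
  by_contra hne
  obtain ⟨ξ, h0, hξ⟩ := Submodule.exists_le_ker_of_lt_top _ (lt_top_iff_ne_top.2 hne)
  refine h ⟨ξ, h0, fun g φ => ?_⟩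
  have := hξ (Submodule.subset_span ⟨(g, φ), rfl⟩)
  rw [LinearMap.mem_ker, map_sub, map_smul, sub_eq_zero] at this
  exact this

theorem restr_mem_twistedAugmentation {V : Set Y} (hV : IsClopen V)
    (hinv : ∀ (g : Γ) x, g • x ∈ V ↔ x ∈ V) {φ : SchwartzFun Y}
    (hφ : φ ∈ twistedAugmentation χ Y) :
    SchwartzFun.restr V hV φ ∈ twistedAugmentation χ Y := by
  have : twistedAugmentation χ Y ≤ (twistedAugmentation χ Y).comap (SchwartzFun.restr V hV) := by
    refine Submodule.span_le.2 ?_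
    rintro _ ⟨⟨g, ψ⟩, rfl⟩
    refine Submodule.subset_span ⟨(g, SchwartzFun.restr V hV ψ), ?_⟩
    rw [map_sub, map_smul, SchwartzFun.restr_translate hV hinv]
  exact this hφ

/-- Restriction to a closed invariant subset is equivariant and surjective on Schwartz functions, so
generators lift to generators. -/
theorem twistedAugmentation_le_map_comap [T2Space Y] [PrespectralSpace Y] {Z : Type*}
    [TopologicalSpace Z] [MulAction Γ Z] [ContinuousConstSMul Γ Z] (ι : Z → Y)
    (hι : IsClosedEmbedding ι) (hinv : ∀ (g : Γ) z, ι (g • z) = g • ι z) :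
    twistedAugmentation χ Z ≤ (twistedAugmentation χ Y).map (SchwartzFun.comap ι hι) := by
  refine Submodule.span_le.2 ?_
  rintro _ ⟨⟨g, ψ⟩, rfl⟩
  obtain ⟨φ, h1, -⟩ := SchwartzFun.exists_extension hι.isEmbedding ψ isOpen_univ (by simp)
  refine ⟨_, Submodule.subset_span ⟨(g, φ), rfl⟩, Subtype.ext (funext fun z => ?_)⟩
  change (φ : Y → ℂ) (g⁻¹ • ι z) - χ g * (φ : Y → ℂ) (ι z)
    = (ψ : Z → ℂ) (g⁻¹ • z) - χ g * (ψ : Z → ℂ) z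
  rw [← hinv, h1, h1]

/-- Localization principle: if the orbit space is Hausdorff, then the existence of a nonzero
semi-invariant distribution implies that some orbit is admissible. -/
theorem exists_isAdmissible_orbit_of_t2Space_quotient [T2Space Y] [PrespectralSpace Y]
    [T2Space (MulAction.orbitRel.Quotient Γ Y)] {ξ : LDistribution Y} (hξ : IsSemiInvariant χ ξ)
    (h0 : ξ ≠ 0) : ∃ y : Y, IsAdmissible χ (MulAction.orbit Γ y) := by
  by_contra! hno
  refine h0 (LinearMap.ext fun φ => ?_)
  let p : Y → MulAction.orbitRel.Quotient Γ Y := Quotient.mk''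
  have hp : Continuous p := continuous_quotient_mk'
  have hpo : IsOpenMap p := isOpenMap_quotient_mk'_mul
  have hpg : ∀ (g : Γ) y, p (g • y) = p y := fun g y => Quotient.sound' ⟨g, rfl⟩
  have hinv : ∀ V : Set (MulAction.orbitRel.Quotient Γ Y), ∀ (g : Γ) x,
      g • x ∈ p ⁻¹' V ↔ x ∈ p ⁻¹' V := fun V g x => by rw [mem_preimage, mem_preimage, hpg]
  obtain ⟨V, hV, hKV, H⟩ :=
    ((SchwartzFun.isCompact_support φ).image hp).exists_isClopen_forall_subset
    (P := fun V => ∀ hV : IsClopen (p ⁻¹' V), ξ (SchwartzFun.restr (p ⁻¹' V) hV φ) = 0)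
    (fun hV => by
      have : SchwartzFun.restr (p ⁻¹' ∅) hV φ = 0 := Subtype.ext (indicator_empty _)
      rw [this, map_zero])
    (fun V W hV hW hVW h1 h2 hVW' => by
      have := SchwartzFun.restr_union (hV.preimage hp) (hW.preimage hp) (hVW.preimage p) φ
      refine (congrArg ξ this).trans ?_
      rw [map_add, h1, h2, add_zero])
    (by
      rintro _ ⟨y, hy, rfl⟩
      have hO : MulAction.orbit Γ y = p ⁻¹' {p y} := by
        ext z
        exact ⟨fun hz => Quotient.sound' hz, fun hz => Quotient.exact' hz⟩
      have hcl : IsClosed (MulAction.orbit Γ y) := hO ▸ isClosed_singleton.preimage hp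
      have hι : IsClosedEmbedding (fun z : MulAction.orbit Γ y => (z : Y)) :=
        hcl.isClosedEmbedding_subtypeVal
      -- As the orbit is not admissible, `φ` agrees on it with some `Ψ` in the augmentation
      -- submodule of `Y`.
      have hmem : SchwartzFun.comap _ hι φ ∈ twistedAugmentation χ (MulAction.orbit Γ y) := by
        rw [twistedAugmentation_eq_top (hno y)]
        trivial
      obtain ⟨Ψ, hΨ, hΨφ⟩ := twistedAugmentation_le_map_comap _ hι (fun _ _ => rfl) hmem
      have hz : ∀ z ∈ MulAction.orbit Γ y, ((φ - Ψ : SchwartzFun Y) : Y → ℂ) z = 0 := by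
        intro z hz
        have := congrFun (congrArg Subtype.val hΨφ) ⟨z, hz⟩
        change (φ : Y → ℂ) z - (Ψ : Y → ℂ) z = 0
        exact sub_eq_zero.2 this.symm
      -- The image of the support of `φ - Ψ` is compact, hence closed in the Hausdorff quotient, and
      -- misses `p y`. Thus `φ = Ψ` over a whole neighbourhood of `p y`, and `p '' A` is clopen
      -- there: open because `p` is open, closed because it is compact.
      have hK := (SchwartzFun.isCompact_support (φ - Ψ)).image hp
      obtain ⟨A, ⟨hAo, hAc⟩, hyA, hA⟩ :=
        PrespectralSpace.isTopologicalBasis.exists_subset_of_mem_open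
          (u := p ⁻¹' (p '' Function.support ((φ - Ψ : SchwartzFun Y) : Y → ℂ))ᶜ) (a := y)
          (by
            rintro ⟨z, hz1, hz2⟩
            exact hz1 (hz z (Quotient.exact' hz2)))
          (hK.isClosed.isOpen_compl.preimage hp)
      refine ⟨p '' A, ⟨(hAc.image hp).isClosed, hpo _ hAo⟩, ⟨y, hyA, rfl⟩,
        fun V hV hVA hV' => ?_⟩
      have h1 : SchwartzFun.restr _ hV' (φ - Ψ) = 0 := by
        refine Subtype.ext (funext fun x => ?_)
        by_cases hx : x ∈ p ⁻¹' V
        · rw [SchwartzFun.restr_apply_of_mem hV' _ hx]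
          obtain ⟨a, ha, hax⟩ := hVA hx
          by_contra hne
          exact hA ha ⟨x, hne, hax.symm⟩
        · exact SchwartzFun.restr_apply_of_notMem hV' _ hx
      rw [map_sub, sub_eq_zero] at h1
      rw [h1]
      exact hξ.apply_eq_zero (restr_mem_twistedAugmentation hV' (hinv V) hΨ))
  have := H V hV subset_rfl (hV.preimage hp)
  rwa [SchwartzFun.restr_eq_self _ φ (fun x hx => by
    by_contra hne
    exact hx (hKV ⟨x, hne, rfl⟩))] at this

end Localization

end

section

open Topology Set
open scoped Pointwise

/-! ### Transport and restriction of semi-invariant distributions -/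

section Transport

variable {Γ : Type*} [Group Γ] {χ : Γ →* ℂˣ}

theorem IsAdmissible.of_homeomorph {A B : Type*} [TopologicalSpace A] [TopologicalSpace B]
    [MulAction Γ A] [MulAction Γ B] [ContinuousConstSMul Γ A] [ContinuousConstSMul Γ B]
    (e : A ≃ₜ B) (he : ∀ (g : Γ) a, e (g • a) = g • e a) (h : IsAdmissible χ A) :
    IsAdmissible χ B := by
  obtain ⟨ξ, h0, hξ⟩ := h
  refine ⟨ξ ∘ₗ SchwartzFun.comap e e.isClosedEmbedding, fun h => h0 (LinearMap.ext fun φ => ?_),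
    fun g φ => ?_⟩
  · have := LinearMap.congr_fun h (SchwartzFun.comap e.symm e.symm.isClosedEmbedding φ)
    have h1 : SchwartzFun.comap e e.isClosedEmbedding
        (SchwartzFun.comap e.symm e.symm.isClosedEmbedding φ) = φ :=
      Subtype.ext (funext fun a => by simp)
    rwa [LinearMap.comp_apply, h1] at this
  · rw [LinearMap.comp_apply, LinearMap.comp_apply, ← hξ]
    congr 1
    exact Subtype.ext (funext fun a => by simp [he])

/-- The orbit of a point of an invariant subset, as an orbit in the ambient space. -/
def SubMulAction.orbitHomeomorph {T : Type*} [MulAction Γ T] [TopologicalSpace T]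
    (S : SubMulAction Γ T) (y : S) : MulAction.orbit Γ y ≃ₜ MulAction.orbit Γ (y : T) where
  toFun z := ⟨z.1.1, by
    obtain ⟨g, hg⟩ := z.2
    exact ⟨g, congrArg Subtype.val hg⟩⟩
  invFun z := ⟨⟨z.1, by
    obtain ⟨g, hg⟩ := z.2
    exact hg ▸ S.smul_mem g y.2⟩, by
    obtain ⟨g, hg⟩ := z.2
    exact ⟨g, Subtype.ext hg⟩⟩
  left_inv _ := rfl
  right_inv _ := rfl
  continuous_toFun := by fun_prop
  continuous_invFun := by fun_prop

end Transport

section Descent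

variable {Γ : Type*} [Group Γ] {χ : Γ →* ℂˣ} {T : Type*} [TopologicalSpace T] [T2Space T]
  [PrespectralSpace T] [MulAction Γ T] [ContinuousConstSMul Γ T]

/-- A semi-invariant distribution restricts to an invariant set which is relatively open in the
support. -/
theorem IsSemiInvariant.exists_restriction {ξ : LDistribution T} (hξ : IsSemiInvariant χ ξ)
    {Ω : Set T} (hΩ : IsOpen Ω) (hne : (ξ.supp ∩ Ω).Nonempty) (Y : SubMulAction Γ T)
    (hY : (Y : Set T) = ξ.supp ∩ Ω) (hΩinv : ∀ (g : Γ) x, x ∈ Ω → g • x ∈ Ω) :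
    ∃ η : LDistribution Y, η ≠ 0 ∧ IsSemiInvariant χ η := by
  have hmem : ∀ y : Y, (y : T) ∈ ξ.supp ∩ Ω := fun y => hY ▸ y.2
  have key : ∀ ψ : SchwartzFun Y, ∃ φ : SchwartzFun T,
      (∀ y : Y, (φ : T → ℂ) y = (ψ : Y → ℂ) y) ∧ ∀ x ∉ Ω, (φ : T → ℂ) x = 0 := fun ψ =>
    SchwartzFun.exists_extension IsEmbedding.subtypeVal ψ hΩ fun y _ => (hmem y).2
  -- The value of `ξ` on an extension vanishing off `Ω` depends only on its restriction to `Y`: the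
  -- difference of two such extensions vanishes on the support. Linearity and invariance of `η`
  -- follow from this.
  have huniq : ∀ φ₁ φ₂ : SchwartzFun T, (∀ y : Y, (φ₁ : T → ℂ) y = (φ₂ : T → ℂ) y) →
      (∀ x ∉ Ω, (φ₁ : T → ℂ) x = 0) → (∀ x ∉ Ω, (φ₂ : T → ℂ) x = 0) → ξ φ₁ = ξ φ₂ := by
    intro φ₁ φ₂ h h1 h2
    rw [← sub_eq_zero, ← map_sub]
    refine ξ.apply_eq_zero_of_supp _ fun x hx => ?_
    change (φ₁ : T → ℂ) x - (φ₂ : T → ℂ) x = 0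
    by_cases hxΩ : x ∈ Ω
    · have hxY : x ∈ (Y : Set T) := hY ▸ ⟨hx, hxΩ⟩
      exact sub_eq_zero.2 (h ⟨x, hxY⟩)
    · rw [h1 x hxΩ, h2 x hxΩ, sub_zero]
  choose E hE1 hE2 using key
  let η : LDistribution Y :=
    { toFun := fun ψ => ξ (E ψ)
      map_add' := fun ψ₁ ψ₂ => by
        rw [← map_add]
        refine huniq _ _ (fun y => ?_) (hE2 _) (fun x hx => ?_)
        · change _ = (E ψ₁ : T → ℂ) y + (E ψ₂ : T → ℂ) y
          rw [hE1, hE1, hE1]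
          rfl
        · change (E ψ₁ : T → ℂ) x + (E ψ₂ : T → ℂ) x = 0
          rw [hE2 _ x hx, hE2 _ x hx, add_zero]
      map_smul' := fun c ψ => by
        rw [← map_smul]
        refine huniq _ _ (fun y => ?_) (hE2 _) (fun x hx => ?_)
        · change _ = c * (E ψ : T → ℂ) y
          rw [hE1, hE1]
          rfl
        · change c * (E ψ : T → ℂ) x = 0
          rw [hE2 _ x hx, mul_zero] }
  refine ⟨η, fun h0 => ?_, fun g ψ => ?_⟩
  · obtain ⟨x, hx, hxΩ⟩ := hne
    obtain ⟨φ, h1, h2⟩ := hx Ω hΩ hxΩ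
    -- `Y` need not be closed in `T`. The restriction still has compact support, since within `Ω`
    -- the set `Y` coincides with the closed set `ξ.supp`.
    have hc : IsCompact (Function.support fun y : Y => (φ : T → ℂ) y) := by
      rw [IsEmbedding.subtypeVal.isCompact_iff]
      have : (Subtype.val '' Function.support fun y : Y => (φ : T → ℂ) y)
          = Function.support (φ : T → ℂ) ∩ ξ.supp := by
        ext z
        constructor
        · rintro ⟨y, hy, rfl⟩
          exact ⟨hy, (hmem y).1⟩
        · rintro ⟨hz, hz'⟩
          have hzY : z ∈ (Y : Set T) := hY ▸ ⟨hz', by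
            by_contra hzΩ
            exact hz (h1 z hzΩ)⟩
          exact ⟨⟨z, hzY⟩, hz, rfl⟩
      rw [this]
      exact (SchwartzFun.isCompact_support φ).inter_right ξ.isClosed_supp
    have hlc : IsLocallyConstant fun y : Y => (φ : T → ℂ) y :=
      φ.2.1.comp_continuous continuous_subtype_val
    let ψ : SchwartzFun Y := ⟨fun y => (φ : T → ℂ) y, hlc, by
      have hcl : IsClosed (Function.support fun y : Y => (φ : T → ℂ) y) :=
        (hlc.isClopen_fiber 0).compl.isClosed
      rw [HasCompactSupport, tsupport, hcl.closure_eq]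
      exact hc⟩
    refine h2 ?_
    rw [huniq φ (E ψ) (fun y => (hE1 ψ y).symm) h1 (hE2 ψ)]
    exact LinearMap.congr_fun h0 ψ
  · change ξ (E _) = _ * ξ (E _)
    rw [← hξ]
    refine huniq _ _ (fun y => ?_) (hE2 _) (fun x hx => ?_)
    · rw [hE1, SchwartzFun.translate_apply, SchwartzFun.translate_apply, ← hE1]
      rfl
    · rw [SchwartzFun.translate_apply]
      refine hE2 _ _ fun h => hx ?_
      simpa using hΩinv g _ h

end Descent

/-! ### Compactness and Baire category for orbits -/

section Orbits

variable {Γ : Type*} [Group Γ] [TopologicalSpace Γ]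
  {T : Type*} [TopologicalSpace T] [T2Space T] [MulAction Γ T] [ContinuousSMul Γ T]

/-- Projection along a compact factor is a closed map. -/
theorem IsCompact.isClosed_setOf_exists_smul_eq {D : Set Γ} (hD : IsCompact D) :
    IsClosed {p : T × T | ∃ d ∈ D, d • p.1 = p.2} := by
  have : CompactSpace D := isCompact_iff_compactSpace.1 hD
  have h : IsClosed {q : D × (T × T) | (q.1 : Γ) • q.2.1 = q.2.2} :=
    isClosed_eq (by fun_prop) (by fun_prop)
  convert isClosedMap_snd_of_compactSpace _ h
  ext p
  constructor
  · rintro ⟨d, hd, h⟩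
    exact ⟨(⟨d, hd⟩, p), h, rfl⟩
  · rintro ⟨⟨d, p⟩, h, rfl⟩
    exact ⟨d, d.2, h⟩

/-- If an orbit is locally closed at one of its points, then the orbit map has a weak openness
property. -/
theorem exists_compactCovering_smul_mem_nhds [LocallyCompactSpace T] [SigmaCompactSpace Γ] (x : T)
    {y : T} (hy : y ∈ MulAction.orbit Γ x) {N C : Set T} (hN : IsOpen N) (hyN : y ∈ N)
    (hC : IsClosed C) (h : MulAction.orbit Γ x ∩ N = C ∩ N) :
    ∃ (n : ℕ) (W : Set T), IsOpen W ∧ x ∈ W ∧ ∀ γ : Γ, γ • x ∈ W →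
      ∃ d ∈ (compactCovering Γ n)⁻¹ * compactCovering Γ n, d • x = γ • x := by
  have hS : IsLocallyClosed (MulAction.orbit Γ x ∩ N) := by
    rw [h]
    exact hC.isLocallyClosed.inter hN.isLocallyClosed
  set S := MulAction.orbit Γ x ∩ N
  have : LocallyCompactSpace S := hS.locallyCompactSpace
  have : Nonempty S := ⟨⟨y, hy, hyN⟩⟩
  -- Baire in the locally compact space `S`, covered by the countably many compact sets
  -- `compactCovering Γ n • x`.
  obtain ⟨n, s, hs⟩ := nonempty_interior_of_iUnion_of_closed
    (f := fun n => ((fun s : S => (s : T)) ⁻¹' ((fun g : Γ => g • x) '' compactCovering Γ n)))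
    (fun n => (((isCompact_compactCovering Γ n).image (by fun_prop)).isClosed).preimage
      continuous_subtype_val)
    (by
      refine eq_univ_of_forall fun s => ?_
      obtain ⟨g, hg⟩ := s.2.1
      obtain ⟨n, hn⟩ := mem_iUnion.1 ((iUnion_compactCovering Γ).symm ▸ mem_univ g :
        g ∈ ⋃ n, compactCovering Γ n)
      exact mem_iUnion.2 ⟨n, g, hn, hg⟩)
  obtain ⟨t, ht, hto, hst⟩ := mem_interior.1 hs
  obtain ⟨N', hN', rfl⟩ := isOpen_induced_iff.1 hto
  obtain ⟨c, hc, hcs⟩ := ht hst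
  -- If `c • γ • x` lies in the open part of `S` covered by level `n`, it equals `c' • x` with `c'`
  -- in that level, so `γ • x = (c⁻¹ * c') • x`.
  refine ⟨n, (fun z => c • z) ⁻¹' (N' ∩ N), (hN'.inter hN).preimage (continuous_const_smul c), ?_,
    fun γ hγ => ?_⟩
  · change c • x ∈ N' ∩ N
    have hcs' : c • x = s := hcs
    rw [hcs']
    exact ⟨hst, s.2.2⟩
  · obtain ⟨c', hc', hcs'⟩ := ht (a := ⟨c • γ • x, ⟨c * γ, mul_smul c γ x⟩, hγ.2⟩) hγ.1
    refine ⟨c⁻¹ * c', mul_mem_mul (inv_mem_inv.2 hc) hc', ?_⟩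
    have : c' • x = c • γ • x := hcs'
    rw [mul_smul, this, inv_smul_smul]

end Orbits

/-! ### An admissible orbit in the support -/

section Main

open TopologicalSpace

variable {Γ : Type*} [Group Γ] [TopologicalSpace Γ] [IsTopologicalGroup Γ] [SigmaCompactSpace Γ]
  {T : Type*} [TopologicalSpace T] [T2Space T] [MulAction Γ T] [ContinuousSMul Γ T]

/-- If all orbits are locally closed somewhere, then on a nonempty relatively open subset of any
nonempty closed set the orbit equivalence relation is given by a compact set. -/
theorem exists_isOpen_forall_exists_smul_eq [LocallyCompactSpace T] [SecondCountableTopology T]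
    (horb : ∀ x : T, ∃ y ∈ MulAction.orbit Γ x, ∃ N C : Set T, IsOpen N ∧ y ∈ N ∧ IsClosed C ∧
      MulAction.orbit Γ x ∩ N = C ∩ N) {Z : Set T} (hZ : IsClosed Z) (hne : Z.Nonempty) :
    ∃ (U : Set T) (D : Set Γ), IsOpen U ∧ (Z ∩ U).Nonempty ∧ IsCompact D ∧
      ∀ z ∈ Z ∩ U, ∀ γ : Γ, γ • z ∈ U → ∃ d ∈ D, d • z = γ • z := by
  let D : ℕ → Set Γ := fun n => (compactCovering Γ n)⁻¹ * compactCovering Γ n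
  have hD : ∀ n, IsCompact (D n) := fun n =>
    (isCompact_compactCovering Γ n).inv.mul (isCompact_compactCovering Γ n)
  let F : ℕ → Set T → Set Z := fun n W =>
    {z | (z : T) ∈ W ∧ ∀ γ : Γ, γ • (z : T) ∈ W → ∃ d ∈ D n, d • (z : T) = γ • (z : T)}
  have : LocallyCompactSpace Z := hZ.isLocallyClosed.locallyCompactSpace
  have : Nonempty Z := hne.to_subtype
  have hcount : Countable (countableBasis T) := (countable_countableBasis T).to_subtype
  -- Second use of Baire, now on `Z`. The sets `F n W`, with `W` in a countable basis, cover `Z` but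
  -- need not be closed, hence the closures.
  obtain ⟨⟨n, W⟩, z, hz⟩ := nonempty_interior_of_iUnion_of_closed
    (f := fun p : ℕ × countableBasis T => closure (F p.1 p.2)) (fun _ => isClosed_closure)
    (by
      refine eq_univ_of_forall fun z => ?_
      obtain ⟨y, hy, N, C, hN, hyN, hC, h⟩ := horb z
      obtain ⟨n, W, hW, hzW, H⟩ := exists_compactCovering_smul_mem_nhds (z : T) hy hN hyN hC h
      obtain ⟨W', hW', hzW', hW'W⟩ :=
        (isBasis_countableBasis T).exists_subset_of_mem_open hzW hW
      exact mem_iUnion.2 ⟨(n, ⟨W', hW'⟩), subset_closure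
        ⟨hzW', fun γ hγ => H γ (hW'W hγ)⟩⟩)
  dsimp only at hz
  have hWo : IsOpen (W : Set T) := isOpen_of_mem_countableBasis W.2
  obtain ⟨O, hO, hOz⟩ := isOpen_induced_iff.1 (isOpen_interior (s := closure (F n W)))
  obtain ⟨z', hz'1, hz'2⟩ := mem_closure_iff.1 (interior_subset hz) _ isOpen_interior hz
  refine ⟨O ∩ W, D n, hO.inter hWo, ⟨z', z'.2, ?_, hz'2.1⟩, hD n, ?_⟩
  · rw [← hOz] at hz'1
    exact hz'1
  · rintro w ⟨hwZ, hwO, hwW⟩ γ ⟨-, hγ⟩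
    have hw : (⟨w, hwZ⟩ : Z) ∈ closure (F n W) := by
      refine interior_subset ?_
      rw [← hOz]
      exact hwO
    have hP : IsClosed {v : Z | ∃ d ∈ D n, d • (v : T) = γ • (v : T)} :=
      (hD n).isClosed_setOf_exists_smul_eq.preimage
        (f := fun v : Z => ((v : T), γ • (v : T))) (by fun_prop)
    have hopen : IsOpen {v : Z | γ • (v : T) ∈ (W : Set T)} :=
      hWo.preimage (f := fun v : Z => γ • (v : T)) (by fun_prop)
    -- For fixed `γ` the condition `γ • v ∈ W` is open and the conclusion `∃ d ∈ D n, d • v = γ • v`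
    -- is closed, so the implication passes from `F n W` to its closure.
    have := closure_mono (s := {v : Z | γ • (v : T) ∈ (W : Set T)} ∩ F n W)
      (t := {v : Z | ∃ d ∈ D n, d • (v : T) = γ • (v : T)})
      (fun v hv => hv.2.2 γ hv.1) (hopen.inter_closure ⟨hγ, hw⟩)
    rw [hP.closure_eq] at this
    exact this

/-- If all orbits are locally closed somewhere, then the support of a nonzero semi-invariant
distribution contains an admissible orbit. -/
theorem IsSemiInvariant.exists_isAdmissible_orbit [PrespectralSpace T] [SecondCountableTopology T]
    (horb : ∀ x : T, ∃ y ∈ MulAction.orbit Γ x, ∃ N C : Set T, IsOpen N ∧ y ∈ N ∧ IsClosed C ∧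
      MulAction.orbit Γ x ∩ N = C ∩ N) {χ : Γ →* ℂˣ} {ξ : LDistribution T}
    (hξ : IsSemiInvariant χ ξ) (h0 : ξ ≠ 0) :
    ∃ x ∈ ξ.supp, IsAdmissible χ (MulAction.orbit Γ x) := by
  obtain ⟨U, D, hU, ⟨u, huZ, huU⟩, hD, H⟩ :=
    exists_isOpen_forall_exists_smul_eq horb ξ.isClosed_supp (LDistribution.supp_nonempty h0)
  let Ω : Set T := ⋃ g : Γ, (fun x => g • x) ⁻¹' U
  have hΩ : IsOpen Ω := isOpen_iUnion fun g => hU.preimage (continuous_const_smul g)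
  have hΩinv : ∀ (g : Γ) x, x ∈ Ω → g • x ∈ Ω := by
    intro g x hx
    obtain ⟨h, hh⟩ := mem_iUnion.1 hx
    refine mem_iUnion.2 ⟨h * g⁻¹, ?_⟩
    rwa [mem_preimage, mul_smul, inv_smul_smul]
  let Y : SubMulAction Γ T :=
    { carrier := ξ.supp ∩ Ω
      smul_mem' := fun g x hx => ⟨hξ.smul_mem_supp g hx.1, hΩinv g x hx.2⟩ }
  have hne : (ξ.supp ∩ Ω).Nonempty := ⟨u, huZ, mem_iUnion.2 ⟨1, by simpa using huU⟩⟩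
  obtain ⟨η, hη0, hη⟩ := hξ.exists_restriction hΩ hne Y rfl hΩinv
  have : PrespectralSpace Y :=
    (ξ.isClosed_supp.isLocallyClosed.inter hΩ.isLocallyClosed).prespectralSpace
  -- Points of `Y` can be moved into `U`, where equivalence means being related by an element of the
  -- compact set `D`. That relation is closed, which gives a neighbourhood of inequivalent pairs.
  have : T2Space (MulAction.orbitRel.Quotient Γ Y) := by
    rw [t2Space_iff_of_isOpenQuotientMap (X := Y) (π := Quotient.mk'')
      (MulAction.isOpenQuotientMap_quotientMk (Γ := Γ) (T := Y)), ← isOpen_compl_iff,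
      isOpen_iff_forall_mem_open]
    rintro ⟨x, y⟩ hxy
    obtain ⟨g, hg⟩ := mem_iUnion.1 x.2.2
    obtain ⟨h, hh⟩ := mem_iUnion.1 y.2.2
    refine ⟨{q : Y × Y | g • (q.1 : T) ∈ U ∧ h • (q.2 : T) ∈ U ∧
      (g • (q.1 : T), h • (q.2 : T)) ∉ {p : T × T | ∃ d ∈ D, d • p.1 = p.2}}, ?_, ?_, hg, hh, ?_⟩
    · rintro ⟨a, b⟩ ⟨ha, hb, hab⟩ heq
      obtain ⟨k, hk⟩ := Quotient.exact' (heq : Quotient.mk'' a = Quotient.mk'' b)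
      have hk' : (k • b : T) = a := congrArg Subtype.val hk
      refine hab ?_
      have hb' : (h * k⁻¹ * g⁻¹) • g • (a : T) = h • (b : T) := by
        rw [← hk', mul_smul, mul_smul, inv_smul_smul, inv_smul_smul]
      obtain ⟨d, hd, hd'⟩ := H (g • (a : T)) ⟨hξ.smul_mem_supp g a.2.1, ha⟩ (h * k⁻¹ * g⁻¹)
        (hb' ▸ hb)
      exact ⟨d, hd, hd'.trans hb'⟩
    · refine (hU.preimage (f := fun q : Y × Y => g • (q.1 : T)) (by fun_prop)).inter
        ((hU.preimage (f := fun q : Y × Y => h • (q.2 : T)) (by fun_prop)).inter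
        (hD.isClosed_setOf_exists_smul_eq.isOpen_compl.preimage
          (f := fun q : Y × Y => (g • (q.1 : T), h • (q.2 : T))) (by fun_prop)))
    · rintro ⟨d, hd, hd'⟩
      refine hxy (Quotient.sound' ⟨g⁻¹ * d⁻¹ * h, Subtype.ext ?_⟩)
      change (g⁻¹ * d⁻¹ * h) • (y : T) = x
      have hd'' : d • g • (x : T) = h • (y : T) := hd'
      rw [mul_smul, mul_smul, ← hd'', inv_smul_smul, inv_smul_smul]
  obtain ⟨y, hy⟩ := exists_isAdmissible_orbit_of_t2Space_quotient hη hη0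
  exact ⟨y, y.2.1, hy.of_homeomorph (Y.orbitHomeomorph y) fun _ _ => rfl⟩

end Main

end

section

open Topology Set Polynomial

/-! ### Persistence of simple roots -/

section Hensel

/-- Simple roots of polynomials over a complete field depend continuously on the coefficients. -/
theorem eventually_exists_root_of_completeSpace {K : Type*} [NontriviallyNormedField K]
    [CompleteSpace K] (p : K[X]) (θ : K) (hp : p.eval θ = 0) (hp' : p.derivative.eval θ ≠ 0)
    {V : Set K} (hV : V ∈ 𝓝 θ) :
    ∀ᶠ c : Fin (p.natDegree + 1) → K in 𝓝 (fun i => p.coeff i),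
      ∃ t ∈ V, ∑ i : Fin (p.natDegree + 1), c i * t ^ (i : ℕ) = 0 := by
  set n := p.natDegree + 1
  let c₀ : Fin n → K := fun i => p.coeff i
  -- The map `(c, t) ↦ (c, ∑ cᵢ tⁱ)` has an invertible derivative at `(c₀, θ)` because `p'(θ) ≠ 0`.
  -- Hence it is open there, and the points `(c, 0)` with `c` near `c₀` are attained.
  let Φ : (Fin n → K) × K → (Fin n → K) × K := fun q => (q.1, ∑ i, q.1 i * q.2 ^ (i : ℕ))
  let D : (Fin n → K) × K →L[K] K := ∑ i : Fin n,
    (c₀ i • (((i : ℕ) • θ ^ ((i : ℕ) - 1)) • ContinuousLinearMap.snd K (Fin n → K) K)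
      + θ ^ (i : ℕ) • (ContinuousLinearMap.proj i).comp (ContinuousLinearMap.fst K (Fin n → K) K))
  have hΦ : HasStrictFDerivAt Φ ((ContinuousLinearMap.fst K (Fin n → K) K).prod D) (c₀, θ) := by
    refine hasStrictFDerivAt_fst.prodMk (HasStrictFDerivAt.fun_sum fun i _ => ?_)
    have h1 : HasStrictFDerivAt (fun q : (Fin n → K) × K => q.1 i)
        ((ContinuousLinearMap.proj i).comp (ContinuousLinearMap.fst K (Fin n → K) K)) (c₀, θ) :=
      ((ContinuousLinearMap.proj (R := K) (φ := fun _ : Fin n => K) i).comp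
        (ContinuousLinearMap.fst K (Fin n → K) K)).hasStrictFDerivAt
    exact h1.mul ((hasStrictFDerivAt_snd (𝕜 := K) (p := (c₀, θ))).pow (i : ℕ))
  have hD : ∀ q, D q = p.derivative.eval θ * q.2 + ∑ i, q.1 i * θ ^ (i : ℕ) := by
    intro q
    have h1 : p.derivative.eval θ = ∑ i : Fin n, p.coeff i * ((i : ℕ) * θ ^ ((i : ℕ) - 1)) := by
      rw [derivative_eval, sum_over_range _ (by simp), Finset.sum_range]
      simp [n, mul_assoc]
    rw [h1, Finset.sum_mul, ← Finset.sum_add_distrib]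
    simp only [D, sum_apply]
    refine Finset.sum_congr rfl fun i _ => ?_
    simp [c₀]
    ring
  let s := p.derivative.eval θ
  let e : ((Fin n → K) × K) ≃L[K] ((Fin n → K) × K) :=
    ContinuousLinearEquiv.equivOfInverse ((ContinuousLinearMap.fst K (Fin n → K) K).prod D)
      ((ContinuousLinearMap.fst K (Fin n → K) K).prod
        (s⁻¹ • (ContinuousLinearMap.snd K (Fin n → K) K - ∑ i : Fin n, θ ^ (i : ℕ) •
          (ContinuousLinearMap.proj i).comp (ContinuousLinearMap.fst K (Fin n → K) K))))
      (fun q => by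
        refine Prod.ext rfl ?_
        have : ∑ i : Fin n, θ ^ (i : ℕ) * q.1 i = ∑ i, q.1 i * θ ^ (i : ℕ) :=
          Finset.sum_congr rfl fun i _ => mul_comm _ _
        simp [hD, this, s, hp'])
      (fun q => by
        refine Prod.ext rfl ?_
        have : ∑ i : Fin n, θ ^ (i : ℕ) * q.1 i = ∑ i, q.1 i * θ ^ (i : ℕ) :=
          Finset.sum_congr rfl fun i _ => mul_comm _ _
        simp [hD, this, s, hp'])
  have hmap := HasStrictFDerivAt.map_nhds_eq_of_equiv (f' := e) hΦ
  have h0 : Φ (c₀, θ) = (c₀, 0) := by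
    refine Prod.ext rfl ?_
    change ∑ i : Fin n, p.coeff i * θ ^ (i : ℕ) = 0
    rw [← hp, eval_eq_sum_range, Finset.sum_range]
  rw [h0] at hmap
  have hmem : Φ '' (univ ×ˢ V) ∈ 𝓝 (c₀, (0 : K)) := by
    rw [← hmap]
    exact Filter.image_mem_map (prod_mem_nhds Filter.univ_mem hV)
  have hcont : Continuous fun c : Fin n → K => (c, (0 : K)) := by fun_prop
  filter_upwards [hcont.continuousAt.preimage_mem_nhds hmem] with c hc
  obtain ⟨⟨c', t⟩, ⟨-, ht⟩, hct⟩ := hc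
  obtain ⟨rfl, h2⟩ := Prod.ext_iff.1 hct
  exact ⟨t, ht, h2⟩

end Hensel

/-! ### Topology of a local field -/

section LocalField

variable {F : Type*} [Field F] [ValuativeRel F] [TopologicalSpace F] [IsNonarchimedeanLocalField F]

open scoped Valued in
open ValuativeRel in
theorem eventually_exists_root (p : F[X]) (θ : F) (hp : p.eval θ = 0)
    (hp' : p.derivative.eval θ ≠ 0) {V : Set F} (hV : V ∈ 𝓝 θ) :
    ∀ᶠ c : Fin (p.natDegree + 1) → F in 𝓝 (fun i => p.coeff i),
      ∃ t ∈ V, ∑ i : Fin (p.natDegree + 1), c i * t ^ (i : ℕ) = 0 := by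
  -- The uniform structure and a rank one valuation turn `F` into a complete normed field with the
  -- given topology.
  let := IsTopologicalAddGroup.rightUniformSpace F
  have := isUniformAddGroup_of_addCommGroup (G := F)
  let : (Valued.v (R := F)).RankOne :=
  { hom' := IsRankLeOne.nonempty.some.emb (R := F).comp MonoidWithZeroHom.ValueGroup₀.embedding
    strictMono' := IsRankLeOne.nonempty.some.strictMono.comp
        MonoidWithZeroHom.ValueGroup₀.embedding_strictMono }
  exact eventually_exists_root_of_completeSpace p θ hp hp' hV

open scoped Valued in
open ValuativeRel in
variable (F) in
theorem IsNonarchimedeanLocalField.secondCountableTopology : SecondCountableTopology F := by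
  let := IsTopologicalAddGroup.rightUniformSpace F
  have := isUniformAddGroup_of_addCommGroup (G := F)
  let : (Valued.v (R := F)).RankOne :=
  { hom' := IsRankLeOne.nonempty.some.emb (R := F).comp MonoidWithZeroHom.ValueGroup₀.embedding
    strictMono' := IsRankLeOne.nonempty.some.strictMono.comp
        MonoidWithZeroHom.ValueGroup₀.embedding_strictMono }
  have : ProperSpace F := .of_nontriviallyNormedField_of_weaklyLocallyCompactSpace F
  infer_instance

variable (F) in
theorem IsNonarchimedeanLocalField.t2Space : T2Space F := by
  let := IsTopologicalAddGroup.rightUniformSpace F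
  have := isUniformAddGroup_of_addCommGroup (G := F)
  infer_instance

variable (F) in
theorem IsNonarchimedeanLocalField.prespectralSpace : PrespectralSpace F := by
  refine ⟨TopologicalSpace.isTopologicalBasis_of_isOpen_of_nhds (fun _ h => h.1)
    fun x U hx hU => ?_⟩
  obtain ⟨γ, hγ⟩ := IsValuativeTopology.mem_nhds_iff'.1 (hU.mem_nhds hx)
  have h1 : IsOpen {z | ValuativeRel.valuation F (z - x) < γ} := by
    refine isOpen_iff_mem_nhds.2 fun z hz => IsValuativeTopology.mem_nhds_iff'.2 ⟨γ, fun w hw => ?_⟩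
    change ValuativeRel.valuation F (z - x) < γ at hz
    change ValuativeRel.valuation F (w - z) < γ at hw
    have := Valuation.map_add_lt _ hw hz
    rwa [sub_add_sub_cancel] at this
  have h2 : IsClosed {z | ValuativeRel.valuation F (z - x) < γ} := by
    refine isOpen_compl_iff.1 (isOpen_iff_mem_nhds.2 fun z hz =>
      IsValuativeTopology.mem_nhds_iff'.2 ⟨γ, fun w hw hw' => hz ?_⟩)
    change ValuativeRel.valuation F (w - z) < γ at hw
    change ValuativeRel.valuation F (w - x) < γ at hw'
    have := Valuation.map_sub_lt _ hw' hw
    rwa [sub_sub_sub_cancel_left] at this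
  refine ⟨_, ⟨h1, ?_⟩, by simp, hγ⟩
  refine ((IsNonarchimedeanLocalField.isCompact_closedBall F γ).image
    (continuous_add_const x)).of_isClosed_subset h2 fun z hz => ⟨z - x, le_of_lt (α := ValuativeRel.ValueGroupWithZero F) hz, ?_⟩
  exact sub_add_cancel z x

open scoped WithZeroTopology in
theorem eventually_normalizedAbs_eq {x : F} (hx : x ≠ 0) :
    ∀ᶠ y in 𝓝 x, normalizedAbs y = normalizedAbs x := by
  have h : (ValuativeRel.valuation F) x ≠ 0 := (_root_.map_ne_zero _).2 hx
  have := IsValuativeTopology.continuous_valuation.tendsto (x : F)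
  rw [WithZeroTopology.nhds_of_ne_zero h, Filter.tendsto_pure] at this
  filter_upwards [this] with y hy
  rw [normalizedAbs, normalizedAbs, hy]

theorem normalizedAbs_mul (x y : F) : normalizedAbs (x * y) = normalizedAbs x * normalizedAbs y := by
  simp [normalizedAbs]

theorem normalizedAbs_pos {x : F} (hx : x ≠ 0) : 0 < normalizedAbs x := by
  simp [normalizedAbs, pos_iff_ne_zero, hx]

end LocalField

end

section

open Topology Set

/-! ### Rational points of affine varieties -/

section AlgHomTopology

variable {F : Type*} [Field F] [TopologicalSpace F] {A B : Type*} [CommRing A] [Algebra F A]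
  [CommRing B] [Algebra F B]

/-- The topology of pointwise convergence on the set of rational points of an `F`-algebra. -/
instance AlgHom.instTopologicalSpacePoints : TopologicalSpace (A →ₐ[F] F) :=
  TopologicalSpace.induced (fun e a => e a) inferInstance

theorem AlgHom.continuous_eval_points (a : A) : Continuous fun e : A →ₐ[F] F => e a :=
  (continuous_apply a).comp continuous_induced_dom

theorem AlgHom.continuous_points_iff {X : Type*} [TopologicalSpace X] {φ : X → (A →ₐ[F] F)} :
    Continuous φ ↔ ∀ a, Continuous fun x => φ x a := by
  rw [continuous_induced_rng, continuous_pi_iff]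
  rfl

theorem AlgHom.continuous_comp_points (f : A →ₐ[F] B) :
    Continuous fun e : B →ₐ[F] F => e.comp f :=
  AlgHom.continuous_points_iff.2 fun a => AlgHom.continuous_eval_points (f a)

theorem AlgHom.isClosedEmbedding_points [IsTopologicalRing F] [T2Space F] {ι : Type*}
    (π : MvPolynomial ι F →ₐ[F] A) (hπ : Function.Surjective π) :
    IsClosedEmbedding fun (e : A →ₐ[F] F) (i : ι) => e (π (MvPolynomial.X i)) := by
  -- Every coordinate function is a polynomial in the chosen generators. This gives both the
  -- comparison of topologies and the equations of the image.
  have hev : ∀ (e : A →ₐ[F] F) (p : MvPolynomial ι F),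
      e (π p) = MvPolynomial.eval (fun i => e (π (MvPolynomial.X i))) p := by
    intro e p
    have : (e.comp π) = MvPolynomial.aeval fun i => e (π (MvPolynomial.X i)) := by
      ext i
      simp
    rw [← AlgHom.comp_apply, this, MvPolynomial.aeval_eq_eval]
  have hr : range (fun (e : A →ₐ[F] F) (i : ι) => e (π (MvPolynomial.X i)))
      = ⋂ p ∈ RingHom.ker π, {v : ι → F | MvPolynomial.eval v p = 0} := by
    ext v
    simp only [mem_iInter]
    constructor
    · rintro ⟨e, rfl⟩ p hp
      change MvPolynomial.eval _ p = 0
      rw [← hev, (RingHom.mem_ker).1 hp, map_zero]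
    · intro h
      refine ⟨Ideal.Quotient.liftₐ (RingHom.ker π) (MvPolynomial.aeval v) (fun p hp => ?_)
        |>.comp (Ideal.quotientKerAlgEquivOfSurjective hπ).symm.toAlgHom, ?_⟩
      · exact h p hp
      · funext i
        have : (Ideal.quotientKerAlgEquivOfSurjective hπ).symm (π (MvPolynomial.X i))
            = Ideal.Quotient.mk _ (MvPolynomial.X i) := by
          rw [AlgEquiv.symm_apply_eq]
          rfl
        simp only [AlgHom.comp_apply, AlgEquiv.coe_toAlgHom, this]
        exact MvPolynomial.aeval_X v i
  choose σ hσ using hπ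
  refine ⟨⟨IsInducing.of_comp (g := fun (v : ι → F) (a : A) => MvPolynomial.eval v (σ a))
    (continuous_pi fun i => AlgHom.continuous_eval_points _)
    (continuous_pi fun a => MvPolynomial.continuous_eval (σ a)) ⟨?_⟩, ?_⟩, ?_⟩
  · refine congrArg (fun f => TopologicalSpace.induced f _) (funext fun e => funext fun a => ?_)
    exact (congrArg e (hσ a)).symm.trans (hev e (σ a))
  · intro e e' h
    refine AlgHom.ext fun a => ?_
    rw [← hσ a, hev, hev]
    exact congrArg (fun v => MvPolynomial.eval v (σ a)) h
  · rw [hr]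
    exact isClosed_biInter fun p _ => isClosed_eq (MvPolynomial.continuous_eval p) continuous_const

end AlgHomTopology

/-! ### Generic smoothness and local openness -/

section GenericSmoothness

/-- At the generic point this is the extension of fraction fields: in characteristic zero `Frac B`
is formally smooth over `Frac A`, which is formally étale over `A`, and `Frac B` is the localization
of `B` at `⊥`. -/
theorem isSmoothAt_bot {A B : Type*} [CommRing A] [CharZero A] [CommRing B] [IsDomain B]
    [Algebra A B] [Algebra.FiniteType A B] (h : Function.Injective (algebraMap A B)) :
    Algebra.IsSmoothAt A (⊥ : Ideal B) := by
  have hA : IsDomain A := h.isDomain (algebraMap A B)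
  let L := FractionRing B
  let K := FractionRing A
  have hAL : Function.Injective (algebraMap A L) := by
    rw [IsScalarTower.algebraMap_eq A B L]
    exact (IsFractionRing.injective B L).comp h
  have : FaithfulSMul A L := (faithfulSMul_iff_algebraMap_injective A L).2 hAL
  let : Algebra K L := FractionRing.liftAlgebra A L
  have : IsScalarTower A K L := FractionRing.isScalarTower_liftAlgebra A L
  have : Algebra.EssFiniteType B L := .of_isLocalization _ (nonZeroDivisors B)
  have : Algebra.EssFiniteType A L := .comp A B L
  have : Algebra.EssFiniteType K L := .of_comp A K L
  have : CharZero K := IsFractionRing.charZero A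
  have : Algebra.FormallySmooth K L := .of_perfectField
  have : Algebra.FormallyEtale A K := .of_isLocalization (nonZeroDivisors A)
  have : Algebra.FormallySmooth A L := .comp A K L
  have hbot : (⊥ : Ideal B).primeCompl = nonZeroDivisors B := by
    ext x
    simp [Ideal.primeCompl]
  have : IsLocalization (⊥ : Ideal B).primeCompl L := by
    rw [hbot]
    exact inferInstanceAs (IsFractionRing B L)
  exact .of_equiv ((IsLocalization.algEquiv (⊥ : Ideal B).primeCompl L
    (Localization.AtPrime (⊥ : Ideal B))).restrictScalars A)

end GenericSmoothness

section LocalField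

variable {F : Type*} [Field F] [ValuativeRel F] [TopologicalSpace F] [IsNonarchimedeanLocalField F]

/-- The map on rational points induced by a dominant morphism of affine varieties is open at some
point, provided that the rational points of the source are dense. -/
theorem exists_range_comp_mem_nhds [CharZero F] {A B : Type*} [CommRing A] [Algebra F A]
    [Algebra.FiniteType F A] [CommRing B] [IsDomain B] [Algebra F B] [Algebra.FiniteType F B]
    (f : A →ₐ[F] B) (hf : Function.Injective f) (hB : ∀ b : B, b ≠ 0 → ∃ e : B →ₐ[F] F, e b ≠ 0)
    {b : B} (hb : b ≠ 0) :
    ∃ e : B →ₐ[F] F, e b ≠ 0 ∧ range (fun e' : B →ₐ[F] F => e'.comp f) ∈ 𝓝 (e.comp f) := by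
  let : Algebra A B := f.toRingHom.toAlgebra
  have : IsScalarTower F A B := .of_algebraMap_eq fun c => (f.commutes c).symm
  have : Algebra.FiniteType A B := .of_restrictScalars_finiteType F A B
  have : IsNoetherianRing A := Algebra.FiniteType.isNoetherianRing F A
  have : Algebra.FinitePresentation A B := Algebra.FinitePresentation.of_finiteType.1 inferInstance
  have : Nontrivial A := f.toRingHom.domain_nontrivial
  have : CharZero A := charZero_of_injective_algebraMap (algebraMap F A).injective
  have := isSmoothAt_bot (A := A) (B := B) hf
  -- After inverting `s`, the algebra is standard étale over the polynomial ring `A[X₁, …, Xₙ]`: a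
  -- simple root of a monic polynomial, with `P.g` inverted.
  obtain ⟨s, hs, n, inst, htower, hetale⟩ :=
    Algebra.IsSmoothAt.exists_isStandardEtale_mvPolynomial (R := A) (S := B) (p := ⊥)
  let S := Localization.Away s
  let R := MvPolynomial (Fin n) A
  obtain ⟨P⟩ := hetale.nonempty_standardEtalePresentation
  obtain ⟨e₀, he₀⟩ := hB (b * s) (mul_ne_zero hb hs)
  rw [map_mul] at he₀
  refine ⟨e₀, left_ne_zero_of_mul he₀, ?_⟩
  let e₀' : S →+* F := IsLocalization.Away.lift (S := S) (g := e₀.toRingHom) s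
    (isUnit_iff_ne_zero.2 (right_ne_zero_of_mul he₀))
  have he₀' : ∀ x : B, e₀' (algebraMap B S x) = e₀ x := fun x =>
    IsLocalization.Away.lift_eq (S := S) (g := e₀.toRingHom) s _ x
  let r₀ : R →+* F := e₀'.comp (algebraMap R S)
  -- The free coordinates are frozen at their values at `e₀`. Then `r e` is the point of `R` over
  -- `e` with these coordinates, and only the root has to move with `e`.
  let t : Fin n → F := fun i => r₀ (MvPolynomial.X i)
  let r : (A →ₐ[F] F) → R →+* F := fun e => MvPolynomial.eval₂Hom e.toRingHom t
  have halg : ∀ a : A, algebraMap R S (MvPolynomial.C a) = algebraMap B S (f a) := fun a =>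
    ((IsScalarTower.algebraMap_apply A R S a).symm.trans (IsScalarTower.algebraMap_apply A B S a))
  have hr₀ : r (e₀.comp f) = r₀ := by
    refine MvPolynomial.ringHom_ext (fun a => ?_) fun i => ?_
    · simp only [r, r₀, MvPolynomial.eval₂Hom_C, RingHom.comp_apply, halg, he₀']
      rfl
    · simp [r, t]
  have hrc : ∀ q : R, Continuous fun e => r e q := by
    intro q
    exact continuous_finsetSum _ fun d _ => (AlgHom.continuous_eval_points _).mul continuous_const
  let θ₀ : F := e₀' P.x
  have hev : ∀ g : Polynomial R, g.eval₂ r₀ θ₀ = e₀' (Polynomial.aeval P.x g) := fun g => by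
    rw [Polynomial.aeval_def, Polynomial.hom_eval₂]
  let p : Polynomial F := P.f.map r₀
  have hp : p.eval θ₀ = 0 := by
    rw [Polynomial.eval_map, hev, P.hasMap.1, map_zero]
  have hp' : p.derivative.eval θ₀ ≠ 0 := by
    rw [Polynomial.derivative_map, Polynomial.eval_map, hev]
    exact (P.hasMap.isUnit_derivative_f.map e₀').ne_zero
  have hg : P.g.eval₂ r₀ θ₀ ≠ 0 := by
    rw [hev]
    exact (P.hasMap.2.map e₀').ne_zero
  have hgc : Continuous fun q : (A →ₐ[F] F) × F => P.g.eval₂ (r q.1) q.2 := by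
    simp only [Polynomial.eval₂_eq_sum, Polynomial.sum]
    exact continuous_finsetSum _ fun i _ =>
      ((hrc _).comp continuous_fst).mul (continuous_snd.pow i)
  have hgn : ∀ᶠ q in 𝓝 (e₀.comp f) ×ˢ 𝓝 θ₀, P.g.eval₂ (r q.1) q.2 ≠ 0 := by
    rw [← nhds_prod_eq]
    have := IsNonarchimedeanLocalField.t2Space F
    exact hgc.continuousAt.eventually_ne (by rwa [hr₀])
  obtain ⟨N, hN, V, hV, hNV⟩ := Filter.eventually_prod_iff.1 hgn
  have hroot := eventually_exists_root p θ₀ hp hp' hV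
  have hcoeff : Continuous fun (e : A →ₐ[F] F) (i : Fin (p.natDegree + 1)) =>
      r e (P.f.coeff i) := continuous_pi fun i => hrc _
  have hcoeff₀ : (fun i : Fin (p.natDegree + 1) => r (e₀.comp f) (P.f.coeff i))
      = fun i : Fin (p.natDegree + 1) => p.coeff i := by
    funext i
    rw [hr₀, Polynomial.coeff_map]
  -- `P.f` is monic, so all its specializations have the same degree and one coefficient space
  -- serves for all `e`.
  have hdeg : p.natDegree = P.f.natDegree := P.monic_f.natDegree_map r₀
  have hroot' := hcoeff.continuousAt.eventually (hcoeff₀ ▸ hroot)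
  filter_upwards [hN, hroot'] with e heN ⟨θ, hθV, hθ⟩
  let : Algebra R F := (r e).toAlgebra
  have hmap : P.HasMap θ := by
    constructor
    · rw [Polynomial.aeval_def, Polynomial.eval₂_eq_sum_range, Finset.sum_range, ← hdeg]
      exact hθ
    · exact isUnit_iff_ne_zero.2 (hNV heN hθV)
  -- A root near `θ₀` at which `P.g` does not vanish is exactly a point of the standard étale
  -- algebra over `r e`.
  let φ : S →ₐ[R] F := (P.P.lift θ hmap).comp P.equivRing.toAlgHom
  have hφ : ∀ a : A, φ (algebraMap B S (f a)) = e a := fun a => by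
    rw [← halg, φ.commutes]
    exact MvPolynomial.eval₂Hom_C _ _ _
  refine ⟨⟨φ.toRingHom.comp (algebraMap B S), fun c => ?_⟩, AlgHom.ext hφ⟩
  rw [← f.commutes]
  exact (hφ _).trans (e.commutes c)

end LocalField

end

section

open Topology Set

/-! ### Images of rational points under morphisms of affine varieties -/

section Constructibility

/-- The primes are the irreducible components of the Zariski closure of `E`; the points of `E` on
each component are dense in it. -/
theorem AlgHom.exists_finset_isPrime {F R : Type*} [Field F] [CommRing R] [Algebra F R]
    [IsNoetherianRing R] (E : Set (R →ₐ[F] F)) :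
    ∃ s : Finset (Ideal R), (∀ P ∈ s, P.IsPrime ∧
      ∀ a ∉ P, ∃ e ∈ E, P ≤ RingHom.ker e ∧ e a ≠ 0) ∧ ∀ e ∈ E, ∃ P ∈ s, P ≤ RingHom.ker e := by
  classical
  let I : Ideal R := ⨅ e ∈ E, RingHom.ker e
  have hI : ∀ e ∈ E, I ≤ RingHom.ker e := fun e he => iInf₂_le e he
  have hfin : I.minimalPrimes.Finite := Ideal.finite_minimalPrimes_of_isNoetherianRing R I
  have hcov : ∀ e ∈ E, ∃ P ∈ hfin.toFinset, P ≤ RingHom.ker e := by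
    intro e he
    have := RingHom.ker_isPrime e
    obtain ⟨P, hP, hPe⟩ := Ideal.exists_minimalPrimes_le (hI e he)
    exact ⟨P, hfin.mem_toFinset.2 hP, hPe⟩
  refine ⟨hfin.toFinset, fun P hP => ?_, hcov⟩
  have hP' := hfin.mem_toFinset.1 hP
  have hPp : P.IsPrime := hP'.1.1
  refine ⟨hPp, fun a ha => ?_⟩
  -- Choose `c ∉ P` in all the other components: a point of `E` where `a * c ≠ 0` must then lie on
  -- `P`.
  have h1 : ¬ (hfin.toFinset.erase P).inf id ≤ P := by
    intro h
    obtain ⟨Q, hQ, hQP⟩ := (Ideal.IsPrime.inf_le' hPp).1 h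
    rw [Finset.mem_erase, hfin.mem_toFinset] at hQ
    exact hQ.1 (le_antisymm hQP (hP'.2 hQ.2.1 hQP))
  obtain ⟨c, hc, hcP⟩ := SetLike.not_le_iff_exists.1 h1
  have hac : a * c ∉ I := fun h => (hPp.mul_notMem ha hcP) (hP'.1.2 h)
  simp only [I, Ideal.mem_iInf, RingHom.mem_ker, not_forall] at hac
  obtain ⟨e, he, hac⟩ := hac
  rw [map_mul] at hac
  obtain ⟨Q, hQ, hQe⟩ := hcov e he
  by_cases hQP : Q = P
  · exact ⟨e, he, hQP ▸ hQe, left_ne_zero_of_mul hac⟩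
  · refine absurd ?_ (right_ne_zero_of_mul hac)
    have hcQ : c ∈ Q := (Finset.inf_le (f := id) (Finset.mem_erase.2 ⟨hQP, hQ⟩) : _ ≤ Q) hc
    exact hQe hcQ

theorem AlgHom.isInducing_comp_of_surjective {F A B : Type*} [Field F] [TopologicalSpace F]
    [CommRing A] [Algebra F A] [CommRing B] [Algebra F B] (π : A →ₐ[F] B)
    (hπ : Function.Surjective π) : IsInducing fun e : B →ₐ[F] F => e.comp π := by
  choose σ hσ using hπ
  refine IsInducing.of_comp (g := fun (e : A →ₐ[F] F) (b : B) => e (σ b))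
    (AlgHom.continuous_comp_points π)
    (continuous_pi fun b => AlgHom.continuous_eval_points (σ b)) ⟨?_⟩
  refine congrArg (fun f => TopologicalSpace.induced f _) (funext fun e => funext fun b => ?_)
  exact (congrArg e (hσ b)).symm

variable {F : Type*} [Field F] [ValuativeRel F] [TopologicalSpace F] [IsNonarchimedeanLocalField F]

/-- The image of rational points under morphisms of affine varieties is locally closed at some
point. -/
theorem exists_isClosed_inter_eq_iUnion_range [CharZero F] {A : Type*} [CommRing A] [Algebra F A]
    [Algebra.FiniteType F A] {ι : Type*} [Finite ι] (B : ι → Type*) [∀ j, CommRing (B j)]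
    [∀ j, Algebra F (B j)] [∀ j, Algebra.FiniteType F (B j)] (f : ∀ j, A →ₐ[F] B j)
    {S : Set (A →ₐ[F] F)} (hS : S = ⋃ j, range fun e : B j →ₐ[F] F => e.comp (f j))
    (hne : S.Nonempty) :
    ∃ e ∈ S, ∃ N C : Set (A →ₐ[F] F), IsOpen N ∧ e ∈ N ∧ IsClosed C ∧ S ∩ N = C ∩ N := by
  classical
  have := Fintype.ofFinite ι
  have hT2 := IsNonarchimedeanLocalField.t2Space F
  have hAN : IsNoetherianRing A := Algebra.FiniteType.isNoetherianRing F A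
  have hBN : ∀ j, IsNoetherianRing (B j) := fun j => Algebra.FiniteType.isNoetherianRing F (B j)
  let J : A → Ideal A := fun t => ⨅ e ∈ {e ∈ S | e t ≠ 0}, RingHom.ker e
  have hJ : ∀ {t a}, a ∈ J t ↔ ∀ e ∈ S, e t ≠ 0 → e a = 0 := by
    intro t a
    simp only [J, Ideal.mem_iInf, RingHom.mem_ker]
    exact ⟨fun h e he he' => h e ⟨he, he'⟩, fun h e he => h e he.1 he.2⟩
  obtain ⟨e₁, he₁⟩ := hne
  -- `J t` is the vanishing ideal of the part of `S` where `t ≠ 0`. A maximal such ideal is prime: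
  -- if `u * v ∈ J t₀` with neither factor in it, then `J (t₀ * v)` is strictly larger, as it
  -- contains `u`.
  obtain ⟨Q, ⟨t₀, ⟨e₂, he₂S, he₂⟩, rfl⟩, hQmax⟩ := set_has_maximal_iff_noetherian.2 hAN
    {Q | ∃ t, (∃ e ∈ S, e t ≠ 0) ∧ J t = Q} ⟨_, 1, ⟨e₁, he₁, by simp⟩, rfl⟩
  have ht₀ : t₀ ∉ J t₀ := fun h => he₂ (hJ.1 h e₂ he₂S he₂)
  have hQprime : (J t₀).IsPrime := by
    refine ⟨fun h => ht₀ (h ▸ Submodule.mem_top), fun {u v} huv => ?_⟩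
    by_contra! hno
    obtain ⟨hu, hv⟩ := hno
    rw [hJ] at hu hv
    push Not at hu hv
    obtain ⟨e, heS, he, hev⟩ := hv
    refine hQmax (J (t₀ * v)) ⟨_, ⟨e, heS, by simp [he, hev]⟩, rfl⟩ (lt_of_le_of_ne ?_ ?_)
    · intro a ha
      rw [hJ] at ha ⊢
      intro e heS he
      rw [map_mul] at he
      exact ha e heS (left_ne_zero_of_mul he)
    · intro heq
      obtain ⟨e', he'S, he', he'u⟩ := hu
      have : u ∈ J t₀ := by
        rw [heq, hJ]
        intro e heS he
        rw [map_mul] at he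
        have := hJ.1 huv e heS (left_ne_zero_of_mul he)
        rw [map_mul] at this
        exact (mul_eq_zero.1 this).resolve_right (right_ne_zero_of_mul he)
      exact he'u (hJ.1 this e' he'S he')
  let E : ∀ j, Set (B j →ₐ[F] F) := fun j => {e | e (f j t₀) ≠ 0}
  have hmemS : ∀ j (e : B j →ₐ[F] F), e.comp (f j) ∈ S := fun j e =>
    hS ▸ mem_iUnion.2 ⟨j, e, rfl⟩
  choose s hs1 hs2 using fun j => AlgHom.exists_finset_isPrime (E j)
  -- The finitely many components of the sources cover the part of `S` where `t₀ ≠ 0`. By primality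
  -- one of them contracts into `J t₀`, so it dominates the closure.
  have hinf : (Finset.univ.sigma s).inf (fun p => p.2.comap (f p.1)) ≤ J t₀ := by
    intro a ha
    rw [hJ]
    intro e heS he
    rw [hS] at heS
    obtain ⟨j, e', rfl⟩ := mem_iUnion.1 heS
    obtain ⟨P, hP, hPe⟩ := hs2 j e' he
    have : a ∈ P.comap (f j) := (Finset.inf_le
      (f := fun p : Sigma fun j => Ideal (B j) => p.2.comap (f p.1)) (b := ⟨j, P⟩) (by simpa)) ha
    exact hPe this
  obtain ⟨⟨j, P⟩, hP, hPQ⟩ := (Ideal.IsPrime.inf_le' hQprime).1 hinf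
  replace hP : P ∈ s j := by simpa using hP
  obtain ⟨hPp, hPd⟩ := hs1 j P hP
  have hQP : J t₀ ≤ P.comap (f j) := by
    intro a ha
    by_contra hno
    obtain ⟨e, heE, -, hea⟩ := hPd _ hno
    exact hea (hJ.1 ha _ (hmemS j e) heE)
  let fbar : A ⧸ J t₀ →ₐ[F] B j ⧸ P := Ideal.quotientMapₐ P (f j) hQP
  have hfbar : Function.Injective fbar :=
    Ideal.quotientMap_injective' (H := hQP) hPQ
  have hdense : ∀ b : B j ⧸ P, b ≠ 0 → ∃ e : B j ⧸ P →ₐ[F] F, e b ≠ 0 := by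
    intro b hb
    obtain ⟨b, rfl⟩ := Ideal.Quotient.mk_surjective b
    obtain ⟨e, -, hPe, heb⟩ := hPd b (fun h => hb (Ideal.Quotient.eq_zero_iff_mem.2 h))
    exact ⟨Ideal.Quotient.liftₐ P e hPe, heb⟩
  have ht₀P : Ideal.Quotient.mk P (f j t₀) ≠ 0 := fun h =>
    ht₀ (hPQ (show f j t₀ ∈ P from Ideal.Quotient.eq_zero_iff_mem.1 h))
  obtain ⟨e, het, hrange⟩ := exists_range_comp_mem_nhds fbar hfbar hdense ht₀P
  have hind := AlgHom.isInducing_comp_of_surjective (Ideal.Quotient.mkₐ F (J t₀))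
    Ideal.Quotient.mk_surjective
  rw [hind.nhds_eq_comap, Filter.mem_comap] at hrange
  obtain ⟨N', hN', hN'r⟩ := hrange
  obtain ⟨N, hNN', hN, heN⟩ := mem_nhds_iff.1 hN'
  -- Where `t₀ ≠ 0`, `S` lies in the zero set of `J t₀`; on `N` that zero set lies in `S`. So `S` is
  -- relatively closed in the intersection of the two open sets.
  refine ⟨(e.comp (Ideal.Quotient.mkₐ F P)).comp (f j), hmemS _ _, N ∩ {e | e t₀ ≠ 0},
    ⋂ q ∈ J t₀, {e | e q = 0}, hN.inter ?_, ⟨heN, het⟩, ?_, ?_⟩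
  · exact isOpen_ne.preimage (AlgHom.continuous_eval_points t₀)
  · exact isClosed_biInter fun q _ =>
      isClosed_singleton.preimage (AlgHom.continuous_eval_points q)
  · ext e'
    constructor
    · rintro ⟨h1, h2, h3⟩
      exact ⟨mem_iInter₂.2 fun q hq => hJ.1 hq e' h1 h3, h2, h3⟩
    · rintro ⟨h1, h2, h3⟩
      refine ⟨?_, h2, h3⟩
      have hker : ∀ q ∈ J t₀, e' q = 0 := fun q hq => mem_iInter₂.1 h1 q hq
      have hlift : (Ideal.Quotient.liftₐ (J t₀) e' hker).comp (Ideal.Quotient.mkₐ F (J t₀)) = e' :=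
        AlgHom.ext fun _ => rfl
      obtain ⟨b, hb⟩ := hN'r (a := Ideal.Quotient.liftₐ (J t₀) e' hker)
        (by rw [mem_preimage, hlift]; exact hNN' h2)
      have : (b.comp (Ideal.Quotient.mkₐ F P)).comp (f j) = e' := by
        rw [← hlift, ← hb]
        exact AlgHom.ext fun _ => rfl
      rw [← this]
      exact hmemS _ _

end Constructibility

end

/-! ### Points of schemes and of affine spectra -/

section

open Topology Set

theorem top_le_preimage_basicOpen {K : Type u} [Field K] {Z : Scheme.{u}} (g : Spec (.of K) ⟶ Z)
    (s : Γ(Z, ⊤)) (h : ⊤ ≤ g ⁻¹ᵁ ⊤)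
    (hs : (Scheme.ΓSpecIso (.of K)).hom (g.appLE ⊤ ⊤ h s) ≠ 0) : ⊤ ≤ g ⁻¹ᵁ Z.basicOpen s := by
  have h1 : IsUnit (g.appLE ⊤ ⊤ h s) :=
    (MulEquiv.isUnit_map (Scheme.ΓSpecIso (.of K)).commRingCatIsoToRingEquiv).1
      (isUnit_iff_ne_zero.2 hs)
  have h2 := Scheme.basicOpen_appLE g ⊤ ⊤ h s
  rw [Scheme.basicOpen_of_isUnit _ h1] at h2
  exact h2.le.trans inf_le_right

section Points

variable {F : Type u} [Field F]

theorem evalOn_comp {K : Type u} [Field K] [Algebra F K] {X Y : Over (Spec (.of F))}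
    (x : Points F K X) (a : X ⟶ Y) (U : Y.left.Opens) (hU : ⊤ ≤ (x ≫ a).left ⁻¹ᵁ U)
    (φ : Γ(Y.left, U)) :
    evalOn (x ≫ a : Points F K Y) U hU φ = evalOn x (a.left ⁻¹ᵁ U) hU (a.left.app U φ) := by
  have h1 : (x.left ≫ a.left).appLE U ⊤ hU = a.left.app U ≫ x.left.appLE _ ⊤ hU :=
    Scheme.Hom.comp_appLE _ _ _ _ _
  exact congrArg (fun t => (Scheme.ΓSpecIso (.of K)).hom t)
    (congrArg (fun t => t.hom φ) h1)

theorem evalOn_res {K : Type u} [Field K] [Algebra F K] {Y : Over (Spec (.of F))}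
    (x : Points F K Y) {U V : Y.left.Opens} (hVU : V ≤ U) (hV : ⊤ ≤ x.left ⁻¹ᵁ V)
    (hU : ⊤ ≤ x.left ⁻¹ᵁ U) (φ : Γ(Y.left, U)) :
    evalOn x V hV (Y.left.presheaf.map (homOfLE hVU).op φ) = evalOn x U hU φ := by
  have h1 : Y.left.presheaf.map (homOfLE hVU).op ≫ x.left.appLE V ⊤ hV = x.left.appLE U ⊤ hU :=
    Scheme.Hom.map_appLE _ _ _
  exact congrArg (fun t => (Scheme.ΓSpecIso (.of K)).hom t) (congrArg (fun t => t.hom φ) h1)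

/-- Evaluation at a point, as a ring homomorphism. -/
def evalOnHom {K : Type u} [Field K] [Algebra F K] {Y : Over (Spec (.of F))} (x : Points F K Y)
    (U : Y.left.Opens) (hU : ⊤ ≤ x.left ⁻¹ᵁ U) : Γ(Y.left, U) →+* K :=
  (x.left.appLE U ⊤ hU ≫ (Scheme.ΓSpecIso (.of K)).hom).hom

variable (F) in
/-- The spectrum of an `F`-algebra, as an `F`-scheme. -/
abbrev SpecOver (T : Type u) [CommRing T] [Algebra F T] : Over (Spec (.of F)) :=
  Over.mk (Spec.map (CommRingCat.ofHom (algebraMap F T)))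

/-- The morphism of spectra induced by a homomorphism of `F`-algebras. -/
def SpecOver.map {T T' : Type u} [CommRing T] [Algebra F T] [CommRing T'] [Algebra F T']
    (e : T →ₐ[F] T') : SpecOver F T' ⟶ SpecOver F T :=
  Over.homMk (Spec.map (CommRingCat.ofHom e.toRingHom)) (by
    change Spec.map _ ≫ Spec.map _ = Spec.map _
    rw [← Spec.map_comp, ← CommRingCat.ofHom_comp]
    congr 2
    exact e.comp_algebraMap)

theorem SpecOver.map_comp {T T' T'' : Type u} [CommRing T] [Algebra F T] [CommRing T']
    [Algebra F T'] [CommRing T''] [Algebra F T''] (e : T →ₐ[F] T') (e' : T' →ₐ[F] T'') :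
    SpecOver.map (e'.comp e) = SpecOver.map e' ≫ SpecOver.map e := by
  ext1
  exact Spec.map_comp (CommRingCat.ofHom e.toRingHom) (CommRingCat.ofHom e'.toRingHom)

theorem SpecOver.map_injective {T T' : Type u} [CommRing T] [Algebra F T] [CommRing T']
    [Algebra F T'] {e e' : T →ₐ[F] T'} (h : SpecOver.map e = SpecOver.map e') : e = e' := by
  have h1 : Spec.map (CommRingCat.ofHom e.toRingHom) = Spec.map (CommRingCat.ofHom e'.toRingHom) :=
    congrArg (fun t : SpecOver F T' ⟶ SpecOver F T => t.left) h
  have h2 := congrArg CommRingCat.Hom.hom (Spec.map_injective h1)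
  exact AlgHom.ext fun x => congrArg (fun t : T →+* T' => t x) h2

theorem SpecOver.map_surjective {T T' : Type u} [CommRing T] [Algebra F T] [CommRing T']
    [Algebra F T'] (x : SpecOver F T' ⟶ SpecOver F T) : ∃ e : T →ₐ[F] T', SpecOver.map e = x := by
  let r : (CommRingCat.of T) ⟶ (CommRingCat.of T') := Spec.preimage x.left
  have hr : Spec.map r = x.left := Spec.map_preimage _
  have hw : x.left ≫ Spec.map (CommRingCat.ofHom (algebraMap F T))
      = Spec.map (CommRingCat.ofHom (algebraMap F T')) := Over.w x
  rw [← hr, ← Spec.map_comp] at hw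
  have hw' := congrArg CommRingCat.Hom.hom (Spec.map_injective hw)
  refine ⟨⟨r.hom, fun c => congrArg (fun t : F →+* T' => t c) hw'⟩, ?_⟩
  ext1
  exact hr

theorem evalOn_SpecOver_map {T K : Type u} [CommRing T] [Algebra F T] [Field K] [Algebra F K]
    (e : T →ₐ[F] K) (t : T) (h : ⊤ ≤ (SpecOver.map e).left ⁻¹ᵁ ⊤) :
    evalOn (SpecOver.map e) ⊤ h ((Scheme.ΓSpecIso (.of T)).inv t) = e t := by
  have h1 : (Scheme.ΓSpecIso (.of T)).inv ≫ (SpecOver.map e).left.appLE ⊤ ⊤ h ≫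
      (Scheme.ΓSpecIso (.of K)).hom = CommRingCat.ofHom e.toRingHom := by
    have h2 : (SpecOver.map e).left.appLE ⊤ ⊤ h
        = (Spec.map (CommRingCat.ofHom e.toRingHom)).appTop :=
      (Scheme.Hom.app_eq_appLE (Spec.map (CommRingCat.ofHom e.toRingHom)) (U := ⊤)).symm
    rw [h2, ← Category.assoc, ← Scheme.ΓSpecIso_inv_naturality, Category.assoc, Iso.inv_hom_id,
      Category.comp_id]
  exact congrArg (fun f => f.hom t) h1

/-- The underlying point of the scheme of a rational point. -/
def RatPoints.pt {Y : Over (Spec (.of F))} (x : RatPoints F Y) : Y.left :=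
  x.left (IsLocalRing.closedPoint F)

theorem RatPoints.top_le_iff {Y : Over (Spec (.of F))} (x : RatPoints F Y) (U : Y.left.Opens) :
    ⊤ ≤ x.left ⁻¹ᵁ U ↔ x.pt ∈ U := by
  constructor
  · intro h
    exact h (trivial : IsLocalRing.closedPoint F ∈ (⊤ : (Spec (.of F)).Opens))
  · intro h p _
    have : p = IsLocalRing.closedPoint F := Subsingleton.elim (α := PrimeSpectrum F) _ _
    rw [this]
    exact h

theorem RatPoints.pt_comp {X Y : Over (Spec (.of F))} (x : RatPoints F X) (a : X ⟶ Y) :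
    RatPoints.pt (x ≫ a : RatPoints F Y) = a.left x.pt :=
  Scheme.Hom.comp_apply x.left a.left _

variable [TopologicalSpace F]

theorem RatPoints.isOpen_setOf_evalOn_mem {Y : Over (Spec (.of F))} (U : Y.left.Opens)
    (φ : Γ(Y.left, U)) {W : Set F} (hW : IsOpen W) :
    IsOpen {x : RatPoints F Y | ∃ hU : ⊤ ≤ x.left ⁻¹ᵁ U, evalOn x U hU φ ∈ W} :=
  TopologicalSpace.isOpen_generateFrom_of_mem ⟨U, φ, W, hW, rfl⟩

theorem RatPoints.isOpen_setOf_pt_mem {Y : Over (Spec (.of F))} (U : Y.left.Opens) :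
    IsOpen {x : RatPoints F Y | x.pt ∈ U} := by
  convert RatPoints.isOpen_setOf_evalOn_mem U 1 isOpen_univ using 1
  ext x
  exact ⟨fun h => ⟨(x.top_le_iff U).2 h, trivial⟩, fun ⟨h, _⟩ => (x.top_le_iff U).1 h⟩

theorem RatPoints.continuous_evalPt {Y : Over (Spec (.of F))} (f : Γ(Y.left, ⊤)) :
    Continuous fun x : RatPoints F Y => evalPt x f := by
  refine continuous_def.2 fun W hW => ?_
  convert RatPoints.isOpen_setOf_evalOn_mem ⊤ f hW using 1
  ext x
  exact ⟨fun h => ⟨_, h⟩, fun ⟨_, h⟩ => h⟩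

theorem SpecOver.continuous_map [IsTopologicalRing F] [ContinuousInv₀ F] [T1Space F] {T : Type u}
    [CommRing T] [Algebra F T] :
    Continuous fun e : T →ₐ[F] F => (SpecOver.map e : RatPoints F (SpecOver F T)) := by
  refine continuous_generateFrom_iff.2 ?_
  rintro _ ⟨U, φ, W, hW, rfl⟩
  refine isOpen_iff_mem_nhds.2 fun e he => ?_
  obtain ⟨hU, heW⟩ := he
  let ψ : T →+* Γ(Spec (.of T), ⊤) := (Scheme.ΓSpecIso (.of T)).inv.hom
  have hψ : Function.Surjective ψ := fun y => ⟨(Scheme.ΓSpecIso (.of T)).hom y, by simp [ψ]⟩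
  have hev : ∀ (e' : T →ₐ[F] F) h t, evalOn (SpecOver.map e') ⊤ h (ψ t) = e' t :=
    fun e' h t => evalOn_SpecOver_map e' t h
  let p : U := ⟨RatPoints.pt (SpecOver.map e), (RatPoints.top_le_iff _ U).1 hU⟩
  -- Near the given point a regular function on `U` is a fraction `a / b ^ n` on a basic open set,
  -- so it is continuous for the pointwise topology.
  obtain ⟨b', hbU, hpb⟩ := (isAffineOpen_top (Spec (.of T))).exists_basicOpen_le p trivial
  obtain ⟨b, rfl⟩ := hψ b'
  let D := (Spec (.of T)).basicOpen (ψ b)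
  have hloc : IsLocalization.Away (ψ b) Γ(Spec (.of T), D) :=
    (isAffineOpen_top (Spec (.of T))).isLocalization_basicOpen (ψ b)
  obtain ⟨⟨a', ⟨_, n, rfl⟩⟩, ha⟩ := IsLocalization.surj (Submonoid.powers (ψ b))
    ((Spec (.of T)).presheaf.map (homOfLE hbU).op φ)
  obtain ⟨a, rfl⟩ := hψ a'
  have hres : ∀ (e' : T →ₐ[F] F) (h : ⊤ ≤ (SpecOver.map e').left ⁻¹ᵁ D) (t : T),
      evalOn (SpecOver.map e') D h (algebraMap Γ(Spec (.of T), ⊤) Γ(Spec (.of T), D) (ψ t))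
        = e' t := by
    intro e' h t
    rw [← hev e' (top_le_preimage_top _)]
    exact evalOn_res (SpecOver.map e' : RatPoints F (SpecOver F T)) le_top h _ (ψ t)
  have hunit : ∀ (e' : T →ₐ[F] F) (h : ⊤ ≤ (SpecOver.map e').left ⁻¹ᵁ D), e' b ≠ 0 := by
    intro e' h
    rw [← hres e' h]
    exact ((IsLocalization.Away.algebraMap_isUnit (S := Γ(Spec (.of T), D)) (ψ b)).map
      (evalOnHom (SpecOver.map e' : RatPoints F (SpecOver F T)) D h)).ne_zero
  have hmem : ∀ e' : T →ₐ[F] F, e' b ≠ 0 → ⊤ ≤ (SpecOver.map e').left ⁻¹ᵁ D := by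
    intro e' he'
    refine top_le_preimage_basicOpen _ (ψ b) (top_le_preimage_top _) ?_
    have h3 := hev e' (top_le_preimage_top _) b
    exact fun h => he' (h3.symm.trans h)
  have hval : ∀ (e' : T →ₐ[F] F) (h : ⊤ ≤ (SpecOver.map e').left ⁻¹ᵁ D)
      (h' : ⊤ ≤ (SpecOver.map e').left ⁻¹ᵁ U),
      evalOn (SpecOver.map e') U h' φ = e' a * (e' b ^ n)⁻¹ := by
    intro e' h h'
    rw [eq_mul_inv_iff_mul_eq₀ (pow_ne_zero _ (hunit e' h)), ← evalOn_res _ hbU h h', ← hres e' h a,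
      ← hres e' h b]
    have := congrArg (evalOnHom (SpecOver.map e' : RatPoints F (SpecOver F T)) D h) ha
    rw [map_mul] at this
    simp only [map_pow] at this
    exact this
  have hD : ⊤ ≤ (SpecOver.map e).left ⁻¹ᵁ D := (RatPoints.top_le_iff _ _).2 hpb
  have hcont : ContinuousAt (fun e' : T →ₐ[F] F => e' a * (e' b ^ n)⁻¹) e :=
    (AlgHom.continuous_eval_points a).continuousAt.mul
      (((AlgHom.continuous_eval_points b).continuousAt.pow n).inv₀ (pow_ne_zero _ (hunit e hD)))
  filter_upwards [hcont.preimage_mem_nhds (hW.mem_nhds (by rwa [← hval e hD hU])),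
    (isOpen_ne.preimage (AlgHom.continuous_eval_points b)).mem_nhds (hunit e hD)] with e' h1 h2
  have h3 := hmem e' h2
  have h4 : ⊤ ≤ (SpecOver.map e').left ⁻¹ᵁ U := fun q hq => hbU (h3 hq)
  refine ⟨h4, ?_⟩
  rw [hval e' h3 h4]
  exact h1

end Points

end

section

open Topology Set CartesianMonoidalCategory TensorProduct

/-! ### Affine charts and the topology on rational points -/

section Charts

variable {F : Type u} [Field F]

/-- An affine open chart of finite type of an `F`-scheme. -/
structure AffineChart (Y : Over (Spec (.of F))) where
  /-- The coordinate ring of the chart. -/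
  ring : Type u
  [commRing : CommRing ring]
  [algebra : Algebra F ring]
  [finiteType : Algebra.FiniteType F ring]
  /-- The inclusion of the chart. -/
  map : SpecOver F ring ⟶ Y
  [isOpenImmersion : IsOpenImmersion map.left]

attribute [instance] AffineChart.commRing AffineChart.algebra AffineChart.finiteType
  AffineChart.isOpenImmersion

theorem AffineChart.exists_mem_range {Y : Over (Spec (.of F))} [LocallyOfFiniteType Y.hom]
    (U : Y.left.Opens) {p : Y.left} (hp : p ∈ U) :
    ∃ c : AffineChart Y, p ∈ range c.map.left ∧ range c.map.left ⊆ U := by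
  obtain ⟨_, ⟨V, hV, rfl⟩, hpV, hVU⟩ := Y.left.isBasis_affineOpens.exists_subset_of_mem_open hp U.2
  have hVa : IsAffineOpen V := hV
  let φ : CommRingCat.of F ⟶ Γ(Y.left, V) := Spec.preimage (hVa.fromSpec ≫ Y.hom)
  have hφ : Spec.map φ = hVa.fromSpec ≫ Y.hom := Spec.map_preimage _
  have hft : LocallyOfFiniteType (Spec.map φ) := hφ ▸ inferInstance
  have hft' : φ.hom.FiniteType := (HasRingHomProperty.Spec_iff (P := @LocallyOfFiniteType)).1 hft
  let : Algebra F Γ(Y.left, V) := φ.hom.toAlgebra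
  have : Algebra.FiniteType F Γ(Y.left, V) := hft'
  let i : SpecOver F Γ(Y.left, V) ⟶ Y := Over.homMk hVa.fromSpec hφ.symm
  have : IsOpenImmersion i.left := inferInstanceAs (IsOpenImmersion hVa.fromSpec)
  refine ⟨⟨Γ(Y.left, V), i⟩, ?_⟩
  have hr : range hVa.fromSpec = V := hVa.range_fromSpec
  change p ∈ range hVa.fromSpec ∧ range hVa.fromSpec ⊆ U
  rw [hr]
  exact ⟨hpV, hVU⟩

theorem AffineChart.exists_finite_cover {Y : Over (Spec (.of F))} [LocallyOfFiniteType Y.hom]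
    (U : Y.left.Opens) (hU : IsCompact (U : Set Y.left)) :
    ∃ (n : ℕ) (c : Fin n → AffineChart Y), (∀ j, range (c j).map.left ⊆ U) ∧
      ∀ p ∈ U, ∃ j, p ∈ range (c j).map.left := by
  choose c hc1 hc2 using fun p : U => AffineChart.exists_mem_range U p.2
  obtain ⟨t, ht⟩ := hU.elim_finite_subcover (fun p : U => range (c p).map.left)
    (fun p => (c p).map.left.isOpenEmbedding.isOpen_range)
    (fun p hp => mem_iUnion.2 ⟨⟨p, hp⟩, hc1 ⟨p, hp⟩⟩)
  refine ⟨t.card, fun j => c (t.equivFin.symm j), fun j => hc2 _, fun p hp => ?_⟩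
  obtain ⟨q, hq, hpq⟩ := mem_iUnion₂.1 (ht hp)
  obtain ⟨j, hj⟩ := t.equivFin.symm.surjective ⟨q, hq⟩
  exact ⟨j, by beta_reduce; rw [hj]; exact hpq⟩

theorem exists_map_comp_eq {T : Type u} [CommRing T] [Algebra F T] {Y : Over (Spec (.of F))}
    (i : SpecOver F T ⟶ Y) [IsOpenImmersion i.left] {T' : Type u} [CommRing T'] [Algebra F T']
    (x : SpecOver F T' ⟶ Y) (hx : range x.left ⊆ range i.left) :
    ∃ e : T →ₐ[F] T', SpecOver.map e ≫ i = x := by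
  have h1 := IsOpenImmersion.lift_fac i.left x.left hx
  obtain ⟨e, he⟩ := SpecOver.map_surjective
    (Over.homMk (IsOpenImmersion.lift i.left x.left hx) (by
      rw [← Over.w i, ← Category.assoc, h1]
      exact Over.w x) : SpecOver F T' ⟶ SpecOver F T)
  refine ⟨e, ?_⟩
  rw [he]
  ext1
  exact h1

theorem RatPoints.exists_map_comp_eq_iff {T : Type u} [CommRing T] [Algebra F T]
    {Y : Over (Spec (.of F))} (i : SpecOver F T ⟶ Y) [IsOpenImmersion i.left]
    (x : RatPoints F Y) : (∃ e : T →ₐ[F] F, SpecOver.map e ≫ i = x) ↔ x.pt ∈ range i.left := by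
  constructor
  · rintro ⟨e, rfl⟩
    exact ⟨_, (RatPoints.pt_comp _ _).symm⟩
  · intro hx
    refine exists_map_comp_eq i x ?_
    rintro _ ⟨p, rfl⟩
    have : p = IsLocalRing.closedPoint F := Subsingleton.elim (α := PrimeSpectrum F) _ _
    rw [this]
    exact hx

variable [TopologicalSpace F] [IsTopologicalRing F] [ContinuousInv₀ F] [T1Space F]

/-- The rational points of an affine open subscheme form an open subspace. -/
theorem SpecOver.isOpenEmbedding_map_comp {T : Type u} [CommRing T] [Algebra F T]
    {Y : Over (Spec (.of F))} (i : SpecOver F T ⟶ Y) [IsOpenImmersion i.left] :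
    IsOpenEmbedding fun e : T →ₐ[F] F => (SpecOver.map e ≫ i : RatPoints F Y) := by
  let j : (T →ₐ[F] F) → RatPoints F Y := fun e => SpecOver.map e ≫ i
  have hj : Continuous j := (RatPoints.continuous_comp i).comp SpecOver.continuous_map
  have hinj : Function.Injective j := by
    intro e e' h
    have : Mono i := Over.mono_of_mono_left i
    exact SpecOver.map_injective ((cancel_mono i).1 h)
  have hrange : IsOpen (range j) := by
    convert RatPoints.isOpen_setOf_pt_mem i.left.opensRange using 1
    ext x
    exact RatPoints.exists_map_comp_eq_iff i x
  refine ⟨⟨⟨le_antisymm (continuous_iff_le_induced.1 hj) ?_⟩, hinj⟩, hrange⟩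
  let τ : TopologicalSpace (T →ₐ[F] F) := TopologicalSpace.induced j inferInstance
  have hτ : @Continuous _ _ τ _ (fun (e : T →ₐ[F] F) (t : T) => e t) := by
    refine @continuous_pi _ _ _ τ _ _ fun t => ⟨fun W hW => ?_⟩
    let ψ : Γ(Spec (.of T), ⊤) := (Scheme.ΓSpecIso (.of T)).inv t
    let U : Y.left.Opens := i.left ''ᵁ ⊤
    -- Each coordinate `t` of the chart is a regular function on its open image, so the topology of
    -- `RatPoints F Y` already makes it continuous.
    let σ : Γ(Y.left, U) := (i.left.appIso ⊤).inv ψ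
    refine ⟨_, RatPoints.isOpen_setOf_evalOn_mem U σ hW, ?_⟩
    have hU : ∀ e : T →ₐ[F] F, ⊤ ≤ (j e).left ⁻¹ᵁ U := fun e =>
      ((j e).top_le_iff U).2 ⟨_, trivial, (RatPoints.pt_comp _ _).symm⟩
    have hev : ∀ e : T →ₐ[F] F, evalOn (j e) U (hU e) σ = e t := by
      intro e
      have h1 : i.left.app U σ = (Spec (.of T)).presheaf.map
          (eqToHom (i.left.preimage_image_eq ⊤)).op ψ :=
        congrArg (fun f => f.hom ψ) (i.left.appIso_inv_app ⊤)
      have h2 : evalOn (j e) U (hU e) σ = _ :=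
        evalOn_comp (SpecOver.map e : RatPoints F (SpecOver F T)) i U (hU e) σ
      rw [h2, h1]
      exact (evalOn_res (SpecOver.map e : RatPoints F (SpecOver F T)) le_top _
        (top_le_preimage_top _) ψ).trans (evalOn_SpecOver_map e t _)
    ext e
    constructor
    · rintro ⟨h, h'⟩
      change e t ∈ W
      rw [← hev e]
      exact h'
    · intro h
      refine ⟨hU e, ?_⟩
      rw [hev e]
      exact h
  exact continuous_iff_le_induced.1 hτ

variable (F) in
-- In charts, a pair of points is a point of the tensor product of the coordinate rings, whose
-- elements are sums of products of functions of either variable.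
theorem RatPoints.continuous_lift (Y Z : Over (Spec (.of F))) [LocallyOfFiniteType Y.hom]
    [LocallyOfFiniteType Z.hom] :
    Continuous fun p : RatPoints F Y × RatPoints F Z =>
      (lift p.1 p.2 : RatPoints F (MonoidalCategoryStruct.tensorObj Y Z)) := by
  refine continuous_iff_continuousAt.2 fun ⟨y, z⟩ => ?_
  obtain ⟨c, hc, -⟩ := AffineChart.exists_mem_range (Y := Y) ⊤ (p := y.pt) trivial
  obtain ⟨d, hd, -⟩ := AffineChart.exists_mem_range (Y := Z) ⊤ (p := z.pt) trivial
  obtain ⟨e, rfl⟩ := (RatPoints.exists_map_comp_eq_iff c.map y).2 hc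
  obtain ⟨e', rfl⟩ := (RatPoints.exists_map_comp_eq_iff d.map z).2 hd
  have hemb := (SpecOver.isOpenEmbedding_map_comp c.map).prodMap
    (SpecOver.isOpenEmbedding_map_comp d.map)
  refine (hemb.continuousAt_iff (x := (e, e'))).1 ?_
  refine Continuous.continuousAt ?_
  let R := TensorProduct F c.ring d.ring
  let m : (c.ring →ₐ[F] F) × (d.ring →ₐ[F] F) → (R →ₐ[F] F) := fun q =>
    Algebra.TensorProduct.lift q.1 q.2 fun _ _ => Commute.all _ _
  let a : SpecOver F R ⟶ MonoidalCategoryStruct.tensorObj Y Z :=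
    lift (SpecOver.map (Algebra.TensorProduct.includeLeft : c.ring →ₐ[F] R) ≫ c.map)
      (SpecOver.map (Algebra.TensorProduct.includeRight : d.ring →ₐ[F] R) ≫ d.map)
  have hm : Continuous m := by
    refine AlgHom.continuous_points_iff.2 fun t => ?_
    induction t using TensorProduct.induction_on with
    | zero => simpa using continuous_const
    | tmul x y =>
      simp only [m]
      exact ((AlgHom.continuous_eval_points x).comp continuous_fst).mul
        ((AlgHom.continuous_eval_points y).comp continuous_snd)
    | add x y hx hy => simp only [map_add]; exact hx.add hy
  have hfac : (fun p : RatPoints F Y × RatPoints F Z =>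
      (lift p.1 p.2 : RatPoints F (MonoidalCategoryStruct.tensorObj Y Z))) ∘
      Prod.map (fun e : c.ring →ₐ[F] F => (SpecOver.map e ≫ c.map : RatPoints F Y))
        (fun e : d.ring →ₐ[F] F => (SpecOver.map e ≫ d.map : RatPoints F Z))
      = fun q => (SpecOver.map (m q) ≫ a : RatPoints F _) := by
    funext q
    simp only [Function.comp_apply, Prod.map, a, comp_lift, ← Category.assoc, ← SpecOver.map_comp]
    congr 3
    · exact (Algebra.TensorProduct.lift_comp_includeLeft _ _ _).symm
    · refine AlgHom.ext fun x => ?_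
      change _ = m q (1 ⊗ₜ x)
      exact ((Algebra.TensorProduct.lift_tmul q.1 q.2 _ 1 x).trans (by simp)).symm
  rw [hfac]
  exact (RatPoints.continuous_comp a).comp (SpecOver.continuous_map.comp hm)

end Charts

end

section

open Topology Set CartesianMonoidalCategory

/-! ### Topological properties of the space of rational points -/

section PiPrespectral

theorem Pi.prespectralSpace {ι : Type*} [Finite ι] {E : ι → Type*} [∀ i, TopologicalSpace (E i)]
    [∀ i, PrespectralSpace (E i)] : PrespectralSpace (∀ i, E i) := by
  cases nonempty_fintype ι
  refine .of_isTopologicalBasis (B := {V | IsOpen V ∧ IsCompact V})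
    (TopologicalSpace.isTopologicalBasis_of_isOpen_of_nhds (fun V hV => hV.1) fun y W hy hW => ?_)
    fun V hV => hV.2
  obtain ⟨u, hu, huW⟩ := isOpen_pi_iff'.1 hW y hy
  choose V hV hyV hVu using fun i => (PrespectralSpace.isTopologicalBasis
    (X := E i)).exists_subset_of_mem_open (hu i).2 (hu i).1
  exact ⟨univ.pi V, ⟨isOpen_set_pi finite_univ fun i _ => (hV i).1,
    isCompact_univ_pi fun i => (hV i).2⟩, fun i _ => hyV i, (pi_mono fun i _ => hVu i).trans huW⟩

end PiPrespectral

section PointsTopology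

theorem RatPoints.exists_chart {F : Type u} [Field F] {Y : Over (Spec (.of F))} [LocallyOfFiniteType Y.hom]
    (y : RatPoints F Y) :
    ∃ (c : AffineChart Y) (e : c.ring →ₐ[F] F), SpecOver.map e ≫ c.map = y := by
  obtain ⟨c, hc, -⟩ := AffineChart.exists_mem_range (Y := Y) ⊤ (p := y.pt) trivial
  obtain ⟨e, he⟩ := (RatPoints.exists_map_comp_eq_iff c.map y).2 hc
  exact ⟨c, e, he⟩

variable {F : Type u} [Field F] [TopologicalSpace F] [IsTopologicalRing F] [T2Space F]

theorem AlgHom.exists_isClosedEmbedding_points (T : Type*) [CommRing T] [Algebra F T]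
    [Algebra.FiniteType F T] : ∃ (n : ℕ) (j : (T →ₐ[F] F) → Fin n → F), IsClosedEmbedding j := by
  obtain ⟨n, π, hπ⟩ := Algebra.FiniteType.iff_quotient_mvPolynomial''.1
    (inferInstance : Algebra.FiniteType F T)
  exact ⟨n, _, AlgHom.isClosedEmbedding_points π hπ⟩

variable [ContinuousInv₀ F]

theorem RatPoints.prespectralSpace [PrespectralSpace F] (Y : Over (Spec (.of F)))
    [LocallyOfFiniteType Y.hom] : PrespectralSpace (RatPoints F Y) := by
  refine .of_isTopologicalBasis (B := {V | IsOpen V ∧ IsCompact V})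
    (TopologicalSpace.isTopologicalBasis_of_isOpen_of_nhds (fun V hV => hV.1) fun y W hy hW => ?_) fun V hV => hV.2
  obtain ⟨c, e, rfl⟩ := y.exists_chart
  have hc := SpecOver.isOpenEmbedding_map_comp c.map
  obtain ⟨n, j, hj⟩ := AlgHom.exists_isClosedEmbedding_points (F := F) c.ring
  have : PrespectralSpace (Fin n → F) := Pi.prespectralSpace
  have : PrespectralSpace (c.ring →ₐ[F] F) := .of_isClosedEmbedding j hj
  obtain ⟨V, hV, heV, hVW⟩ := (PrespectralSpace.isTopologicalBasis
    (X := c.ring →ₐ[F] F)).exists_subset_of_mem_open hy (hW.preimage hc.continuous)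
  exact ⟨_, ⟨hc.isOpenMap _ hV.1, hV.2.image hc.continuous⟩, ⟨e, heV, rfl⟩, image_subset_iff.2 hVW⟩

theorem RatPoints.secondCountableTopology [SecondCountableTopology F] (Y : Over (Spec (.of F)))
    [LocallyOfFiniteType Y.hom] [QuasiCompact Y.hom] :
    SecondCountableTopology (RatPoints F Y) := by
  have : CompactSpace Y.left := (quasiCompact_iff_compactSpace Y.hom).1 inferInstance
  obtain ⟨n, c, -, hc⟩ := AffineChart.exists_finite_cover (Y := Y) ⊤ isCompact_univ
  have hemb := fun k => SpecOver.isOpenEmbedding_map_comp (F := F) (c k).map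
  have : ∀ k, SecondCountableTopology
      (range fun e : (c k).ring →ₐ[F] F => (SpecOver.map e ≫ (c k).map : RatPoints F Y)) := by
    intro k
    obtain ⟨n, j, hj⟩ := AlgHom.exists_isClosedEmbedding_points (F := F) (c k).ring
    have := hj.isInducing.secondCountableTopology
    exact (hemb k).isEmbedding.toHomeomorph.symm.secondCountableTopology
  refine TopologicalSpace.secondCountableTopology_of_countable_cover (fun k => (hemb k).isOpen_range)
    (eq_univ_of_forall fun y => ?_)
  obtain ⟨k, hk⟩ := hc y.pt trivial
  exact mem_iUnion.2 ⟨k, (RatPoints.exists_map_comp_eq_iff (c k).map y).2 hk⟩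

/-- If the pair `(x, y)` lies off the diagonal, the closed diagonal has open complement. Otherwise
`x` and `y` have the same underlying scheme point, hence share an affine chart, whose rational
points are Hausdorff. -/
theorem RatPoints.t2Space (Y : Over (Spec (.of F))) [LocallyOfFiniteType Y.hom]
    [IsSeparated Y.hom] : T2Space (RatPoints F Y) := by
  refine ⟨fun x y hxy => ?_⟩
  let D : Y ⟶ MonoidalCategoryStruct.tensorObj Y Y := lift (𝟙 Y) (𝟙 Y)
  have hD : IsClosedImmersion D.left :=
    inferInstanceAs (IsClosedImmersion (Limits.pullback.diagonal Y.hom))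
  have hfst : ∀ a b : RatPoints F Y, (fst Y Y).left (RatPoints.pt
      (lift a b : RatPoints F (MonoidalCategoryStruct.tensorObj Y Y))) = a.pt := fun a b => by
    rw [← RatPoints.pt_comp, lift_fst]
  have hsnd : ∀ a b : RatPoints F Y, (snd Y Y).left (RatPoints.pt
      (lift a b : RatPoints F (MonoidalCategoryStruct.tensorObj Y Y))) = b.pt := fun a b => by
    rw [← RatPoints.pt_comp, lift_snd]
  by_cases h : RatPoints.pt (lift x y : RatPoints F (MonoidalCategoryStruct.tensorObj Y Y)) ∈
      range D.left
  · obtain ⟨p, hp⟩ := h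
    have hxp : x.pt = p := by
      rw [← hfst x y, ← hp, ← Scheme.Hom.comp_apply, ← Over.comp_left, lift_fst]
      rfl
    have hyp : y.pt = p := by
      rw [← hsnd x y, ← hp, ← Scheme.Hom.comp_apply, ← Over.comp_left, lift_snd]
      rfl
    obtain ⟨c, hc, -⟩ := AffineChart.exists_mem_range (Y := Y) ⊤ (p := p) trivial
    obtain ⟨e, rfl⟩ := (RatPoints.exists_map_comp_eq_iff c.map x).2 (hxp ▸ hc)
    obtain ⟨e', rfl⟩ := (RatPoints.exists_map_comp_eq_iff c.map y).2 (hyp ▸ hc)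
    have hemb := SpecOver.isOpenEmbedding_map_comp c.map
    obtain ⟨n, j, hj⟩ := AlgHom.exists_isClosedEmbedding_points (F := F) c.ring
    have : T2Space (c.ring →ₐ[F] F) := hj.isEmbedding.t2Space
    obtain ⟨U, V, hU, hV, heU, heV, hUV⟩ := t2_separation (x := e) (y := e')
      (fun h => hxy (by rw [h]))
    exact ⟨_, _, hemb.isOpenMap _ hU, hemb.isOpenMap _ hV, ⟨e, heU, rfl⟩, ⟨e', heV, rfl⟩,
      (disjoint_image_iff hemb.injective).2 hUV⟩
  · have hopen := (RatPoints.isOpen_setOf_pt_mem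
      ⟨(range D.left)ᶜ, D.left.isClosedEmbedding.isClosed_range.isOpen_compl⟩).preimage
        (RatPoints.continuous_lift F Y Y)
    obtain ⟨U, V, hU, hV, hxU, hyV, hUV⟩ := isOpen_prod_iff.1 hopen x y h
    refine ⟨U, V, hU, hV, hxU, hyV, disjoint_left.2 fun a haU haV => ?_⟩
    refine hUV (mk_mem_prod haU haV) ⟨a.pt, ?_⟩
    rw [← RatPoints.pt_comp]
    congr 1
    simp [D, comp_lift]

theorem RatPoints.isTopologicalGroup (G : Over (Spec (.of F))) [GrpObj G]
    [LocallyOfFiniteType G.hom] : IsTopologicalGroup (RatPoints F G) where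
  continuous_mul := (RatPoints.continuous_comp MonObj.mul).comp (RatPoints.continuous_lift F G G)
  continuous_inv := RatPoints.continuous_comp GrpObj.inv

theorem RatPoints.continuousSMul (G X : Over (Spec (.of F))) [GrpObj G] [ModObj G X]
    [LocallyOfFiniteType G.hom] [LocallyOfFiniteType X.hom] :
    ContinuousSMul (RatPoints F G) (RatPoints F X) where
  continuous_smul := (RatPoints.continuous_comp ModObj.smul).comp (RatPoints.continuous_lift F G X)

theorem RatPoints.sigmaCompactSpace [SecondCountableTopology F] [PrespectralSpace F]
    (Y : Over (Spec (.of F))) [LocallyOfFiniteType Y.hom] [QuasiCompact Y.hom] :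
    SigmaCompactSpace (RatPoints F Y) := by
  have := RatPoints.secondCountableTopology Y
  have := RatPoints.prespectralSpace Y
  infer_instance

end PointsTopology

end

section

open Topology Set CartesianMonoidalCategory

/-! ### Local closedness of orbits -/

section Orbits

variable {F : Type u} [Field F] [ValuativeRel F] [TopologicalSpace F] [IsNonarchimedeanLocalField F]
  [CharZero F]

/-- The image on rational points of a morphism of varieties over a local field of characteristic
zero is locally closed at one of its points. -/
theorem RatPoints.exists_isClosed_inter_eq_range {Y Z : Over (Spec (.of F))}
    [LocallyOfFiniteType Y.hom] [LocallyOfFiniteType Z.hom] [CompactSpace Z.left] (o : Z ⟶ Y)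
    (z₀ : RatPoints F Z) :
    ∃ y ∈ range fun z : RatPoints F Z => (z ≫ o : RatPoints F Y),
      ∃ N C : Set (RatPoints F Y), IsOpen N ∧ y ∈ N ∧ IsClosed C ∧
        (range fun z : RatPoints F Z => (z ≫ o : RatPoints F Y)) ∩ N = C ∩ N := by
  have := IsNonarchimedeanLocalField.t2Space F
  set S := range fun z : RatPoints F Z => (z ≫ o : RatPoints F Y) with hS
  obtain ⟨c, e₀, he₀⟩ := RatPoints.exists_chart (z₀ ≫ o : RatPoints F Y)
  have : IsLocallyNoetherian Z.left := LocallyOfFiniteType.isLocallyNoetherian Z.hom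
  have : IsNoetherian Z.left := {}
  obtain ⟨n, R, hRU, hUR⟩ := AffineChart.exists_finite_cover (o.left ⁻¹ᵁ c.map.left.opensRange)
    (TopologicalSpace.NoetherianSpace.isCompact _)
  have hf : ∀ j, ∃ f : c.ring →ₐ[F] (R j).ring, SpecOver.map f ≫ c.map = (R j).map ≫ o := by
    intro j
    refine exists_map_comp_eq c.map ((R j).map ≫ o) ?_
    rintro _ ⟨p, rfl⟩
    rw [Over.comp_left, Scheme.Hom.comp_apply]
    exact hRU j ⟨p, rfl⟩
  choose f hf using hf
  have hφ := SpecOver.isOpenEmbedding_map_comp (F := F) c.map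
  set φ := fun e : c.ring →ₐ[F] F => (SpecOver.map e ≫ c.map : RatPoints F Y) with hφdef
  have hS' : φ ⁻¹' S = ⋃ j, range fun e : (R j).ring →ₐ[F] F => e.comp (f j) := by
    ext e
    constructor
    · rintro ⟨z, hz⟩
      have hzU : z.pt ∈ o.left ⁻¹ᵁ c.map.left.opensRange := by
        change o.left z.pt ∈ range c.map.left
        rw [← RatPoints.pt_comp]
        exact (RatPoints.exists_map_comp_eq_iff c.map _).1 ⟨e, hz.symm⟩
      obtain ⟨j, hj⟩ := hUR _ hzU
      obtain ⟨e', rfl⟩ := (RatPoints.exists_map_comp_eq_iff (R j).map z).2 hj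
      refine mem_iUnion.2 ⟨j, e', hφ.injective ?_⟩
      rw [← hz]
      change SpecOver.map (e'.comp (f j)) ≫ c.map = (SpecOver.map e' ≫ (R j).map) ≫ o
      rw [SpecOver.map_comp, Category.assoc, Category.assoc, hf]
    · intro h
      obtain ⟨j, e', rfl⟩ := mem_iUnion.1 h
      refine ⟨SpecOver.map e' ≫ (R j).map, ?_⟩
      change (SpecOver.map e' ≫ (R j).map) ≫ o = SpecOver.map (e'.comp (f j)) ≫ c.map
      rw [SpecOver.map_comp, Category.assoc, Category.assoc, hf]
  obtain ⟨e, he, N, C, hN, heN, hC, hSNC⟩ := exists_isClosed_inter_eq_iUnion_range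
    (fun j => (R j).ring) f hS' ⟨e₀, z₀, he₀.symm⟩
  -- The image of `C` need not be closed outside the chart; the complement of the open set `φ '' (N
  -- \ C)` is closed and has the same trace on `φ '' N`.
  refine ⟨φ e, he, φ '' N, (φ '' (N \ C))ᶜ, hφ.isOpenMap _ hN, ⟨e, heN, rfl⟩,
    (hφ.isOpenMap _ (hN.sdiff hC)).isClosed_compl, ?_⟩
  ext y
  constructor
  · rintro ⟨hy, a, ha, rfl⟩
    refine ⟨?_, a, ha, rfl⟩
    rintro ⟨b, hb, hab⟩
    obtain rfl := hφ.injective hab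
    have : b ∈ φ ⁻¹' S ∩ N := ⟨hy, ha⟩
    rw [hSNC] at this
    exact hb.2 this.1
  · rintro ⟨hy, a, ha, rfl⟩
    refine ⟨?_, a, ha, rfl⟩
    have : a ∈ C ∩ N := ⟨by_contra fun h => hy ⟨a, ⟨ha, h⟩, rfl⟩, ha⟩
    rw [← hSNC] at this
    exact this.1

theorem RatPoints.exists_orbit_inter_eq (G X : Over (Spec (.of F))) [GrpObj G] [ModObj G X]
    [LocallyOfFiniteType G.hom] [CompactSpace G.left] [LocallyOfFiniteType X.hom]
    (x : RatPoints F X) :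
    ∃ y ∈ MulAction.orbit (RatPoints F G) x, ∃ N C : Set (RatPoints F X), IsOpen N ∧ y ∈ N ∧
      IsClosed C ∧ MulAction.orbit (RatPoints F G) x ∩ N = C ∩ N := by
  have hid : Spec.map (CommRingCat.ofHom (algebraMap F F)) = 𝟙 (Spec (.of F)) := Spec.map_id _
  let s : G ⟶ Over.mk (Spec.map (CommRingCat.ofHom (algebraMap F F))) :=
    Over.homMk G.hom (by simp)
  have hs : ∀ g : RatPoints F G, g ≫ s = 𝟙 _ := fun g => by
    ext1
    have hw : g.left ≫ G.hom = Spec.map (CommRingCat.ofHom (algebraMap F F)) := Over.w g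
    exact hw.trans hid
  -- The orbit map `g ↦ g • x` comes from a morphism of schemes: the identity of `G` acting on the
  -- constant `G`-valued point `x`.
  have h : (fun g : RatPoints F G => (g ≫ ((𝟙 G : G ⟶ G) • (s ≫ x)) : RatPoints F X)) =
      fun g => g • x := by
    funext g
    rw [ModObj.comp_smul, ← Category.assoc, hs, Category.id_comp, Category.comp_id]
  have := RatPoints.exists_isClosed_inter_eq_range ((𝟙 G : G ⟶ G) • (s ≫ x)) 1
  rw [h] at this
  exact this

end Orbits

end

section

open Topology Set Filter TopologicalSpace

/-! ### Meromorphic continuation and Laurent order -/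

section MeromorphicLemmas

/-- Identity theorem. Values at isolated points are arbitrary, so only equality on punctured
neighbourhoods can be expected. -/
theorem Meromorphic.eventuallyEq_of_forall_lt_re {M M' : ℂ → ℂ} (hM : Meromorphic M)
    (hM' : Meromorphic M') {σ : ℝ} (h : ∀ s : ℂ, σ < s.re → M s = M' s) (z : ℂ) :
    M =ᶠ[𝓝[≠] z] M' := by
  have hD := hM.sub hM'
  have htop : meromorphicOrderAt (M - M') z = ⊤ := by
    by_contra hz
    have := hD.exists_meromorphicOrderAt_ne_top_iff_forall.1 ⟨z, hz⟩ ((σ + 1 : ℝ) : ℂ)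
    refine this (meromorphicOrderAt_eq_top_iff.2 (Filter.Eventually.filter_mono nhdsWithin_le_nhds ?_))
    have hopen : IsOpen {s : ℂ | σ < s.re} := isOpen_lt continuous_const Complex.continuous_re
    filter_upwards [hopen.mem_nhds (show σ < ((σ + 1 : ℝ) : ℂ).re by simp)] with s hs
    simp [h s hs]
  filter_upwards [meromorphicOrderAt_eq_top_iff.1 htop] with s hs
  exact sub_eq_zero.1 hs

theorem meromorphicOrderAt_pow_mul {M : ℂ → ℂ} (hM : MeromorphicAt M 0) (n : ℕ) :
    meromorphicOrderAt (fun s => s ^ n * M s) 0 = n + meromorphicOrderAt M 0 := by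
  have h1 : MeromorphicAt (fun s : ℂ => s ^ n) 0 := (analyticAt_id.pow n).meromorphicAt
  have h2 : meromorphicOrderAt (fun s : ℂ => s ^ n) 0 = n := by
    rw [show (fun s : ℂ => s ^ n) = id ^ n from rfl, meromorphicOrderAt_pow (.id 0),
      meromorphicOrderAt_id, mul_one]
  rw [← h2]
  exact meromorphicOrderAt_mul h1 hM

/-- A zero limit means positive, hence at least unit, order, so one factor `s` can be dropped. This
makes the leading coefficient nonzero. -/
theorem MeromorphicAt.exists_tendsto_pow_mul_of_tendsto_zero {M : ℂ → ℂ} (hM : MeromorphicAt M 0)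
    {n : ℕ} (h : Tendsto (fun s => s ^ (n + 1) * M s) (𝓝[≠] 0) (𝓝 0)) :
    ∃ c, Tendsto (fun s => s ^ n * M s) (𝓝[≠] 0) (𝓝 c) := by
  have hm : ∀ k : ℕ, MeromorphicAt (fun s => s ^ k * M s) 0 := fun k =>
    (analyticAt_id.pow k).meromorphicAt.mul hM
  have h1 := (tendsto_zero_iff_meromorphicOrderAt_pos (hm _)).1 h
  refine (tendsto_nhds_iff_meromorphicOrderAt_nonneg (hm _)).2 ?_
  rw [meromorphicOrderAt_pow_mul hM] at h1 ⊢
  cases hk : meromorphicOrderAt M 0 with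
  | top => simp
  | coe k =>
    rw [hk] at h1
    have h3 : (0 : ℤ) < (n + 1 : ℕ) + k := by exact_mod_cast h1
    have h4 : (0 : ℤ) ≤ n + k := by push_cast at h3; omega
    exact_mod_cast h4

end MeromorphicLemmas

/-! ### Exhaustion by compact open sets -/

section Exhaustion

variable {Y : Type*} [TopologicalSpace Y]

/-- An exhaustion of a space by compact open subsets. -/
structure IsExhaustion (K : ℕ → CompactOpens Y) : Prop where
  monotone : Monotone K
  iUnion_eq : ⋃ n, (K n : Set Y) = univ

variable (Y) in
theorem exists_isExhaustion [PrespectralSpace Y] [SecondCountableTopology Y] :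
    ∃ K : ℕ → CompactOpens Y, IsExhaustion K := by
  choose V hVo hVc hV _ using fun n => (isCompact_compactCovering Y n).exists_isCompact_isOpen_between
    isOpen_univ (subset_univ _)
  let K : ℕ → CompactOpens Y := fun n => ⟨⟨V n, hVc n⟩, hVo n⟩
  refine ⟨partialSups K, (partialSups K).monotone, eq_univ_of_forall fun y => ?_⟩
  obtain ⟨n, hn⟩ := mem_iUnion.1 ((iUnion_compactCovering Y).symm ▸ mem_univ y)
  exact mem_iUnion.2 ⟨n, (le_partialSups K n : (K n : Set Y) ⊆ _) (hV n hn)⟩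

theorem IsExhaustion.eventually_subset {K : ℕ → CompactOpens Y} (hK : IsExhaustion K) {C : Set Y}
    (hC : IsCompact C) : ∀ᶠ n in atTop, C ⊆ K n := by
  obtain ⟨n, hn⟩ := hC.elim_directed_cover (fun n => (K n : Set Y)) (fun n => (K n).isOpen)
    (hK.iUnion_eq ▸ subset_univ _) (directed_of_isDirected_le fun _ _ h => hK.monotone h)
  filter_upwards [eventually_ge_atTop n] with m hm
  exact hn.trans (hK.monotone hm)

variable [T2Space Y]

/-- The restriction of a locally constant function to a compact open set. -/
def SchwartzFun.cutoff (ψ : Y → ℂ) (hψ : IsLocallyConstant ψ) (K : CompactOpens Y) :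
    SchwartzFun Y :=
  ⟨(K : Set Y).indicator ψ, by
    refine (IsLocallyConstant.iff_eventually_eq _).2 fun x => ?_
    by_cases hx : x ∈ (K : Set Y)
    · filter_upwards [hψ.eventually_eq x, K.isOpen.mem_nhds hx] with y hy hyV
      simp [hx, hyV, hy]
    · filter_upwards [K.isCompact.isClosed.isOpen_compl.mem_nhds hx] with y hyV
      rw [indicator_of_notMem hx, indicator_of_notMem hyV], by
    refine K.isCompact.of_isClosed_subset (isClosed_tsupport _)
      (closure_minimal ?_ K.isCompact.isClosed)
    exact Set.support_indicator_subset⟩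

/-- This expresses the integral through `μ` alone, so that different choices of `m` and `h` for
different test functions need not be compared. -/
theorem IsPolarDecomposition.tendsto_cutoff [MeasurableSpace Y] [BorelSpace Y]
    {μ : LDistribution Y} {m : MeasureTheory.Measure Y} {h : Y → ℂ}
    (hμ : IsPolarDecomposition μ m h) {ψ : Y → ℂ} (hψ : IsLocallyConstant ψ)
    (hint : MeasureTheory.Integrable (fun y => ψ y * h y) m) {K : ℕ → CompactOpens Y}
    (hK : IsExhaustion K) :
    Tendsto (fun n => μ (SchwartzFun.cutoff ψ hψ (K n))) atTop (𝓝 (∫ y, ψ y * h y ∂m)) := by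
  have h1 := MeasureTheory.tendsto_setIntegral_of_monotone (μ := m) (f := fun y => ψ y * h y)
    (s := fun n => (K n : Set Y)) (fun n => (K n).isOpen.measurableSet)
    (fun _ _ h => hK.monotone h) hint.integrableOn
  rw [hK.iUnion_eq, MeasureTheory.Measure.restrict_univ] at h1
  refine h1.congr fun n => ?_
  rw [hμ.apply_eq, ← MeasureTheory.integral_indicator (K n).isOpen.measurableSet]
  refine MeasureTheory.integral_congr_ae (.of_forall fun y => ?_)
  change _ = (K n : Set Y).indicator ψ y * h y
  by_cases hy : y ∈ (K n : Set Y) <;> simp [hy]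

end Exhaustion

/-! ### Regularization and its leading coefficient -/

section Regularization

variable {T Γ : Type*} [TopologicalSpace T] [Group Γ] [MulAction Γ T]
  {U : SubMulAction Γ T}

theorem isLocallyConstant_mul_cpow {a : U → ℝ} (ha : IsLocallyConstant a) (φ : SchwartzFun T)
    (s : ℂ) : IsLocallyConstant fun x : U => (φ : T → ℂ) x * (a x : ℂ) ^ s :=
  (φ.2.1.comp_continuous continuous_subtype_val).mul (ha.comp fun t : ℝ => (t : ℂ) ^ s)

variable [T2Space T]

/-- `M` is a meromorphic function which on a right half-plane is the limit of the values of `μ` at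
the truncations of `φ a ^ s` along any exhaustion by compact open subsets. -/
def IsRegularization (μ : LDistribution U) {a : U → ℝ} (ha : IsLocallyConstant a)
    (φ : SchwartzFun T) (M : ℂ → ℂ) : Prop :=
  Meromorphic M ∧ ∃ σ : ℝ, ∀ s : ℂ, σ < s.re → ∀ K : ℕ → CompactOpens U, IsExhaustion K →
    Tendsto (fun n => μ (SchwartzFun.cutoff _ (isLocallyConstant_mul_cpow ha φ s) (K n))) atTop
      (𝓝 (M s))

namespace IsRegularization

variable {μ : LDistribution U} {a : U → ℝ} {ha : IsLocallyConstant a} {φ φ' : SchwartzFun T}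
  {M M' : ℂ → ℂ}

theorem add (h : IsRegularization μ ha φ M) (h' : IsRegularization μ ha φ' M') :
    IsRegularization μ ha (φ + φ') (M + M') := by
  obtain ⟨hM, σ, hσ⟩ := h
  obtain ⟨hM', σ', hσ'⟩ := h'
  refine ⟨hM.add hM', max σ σ', fun s hs K hK => ?_⟩
  refine ((hσ s ((le_max_left _ _).trans_lt hs) K hK).add
    (hσ' s ((le_max_right _ _).trans_lt hs) K hK)).congr fun n => ?_
  rw [← map_add]
  congr 1
  refine Subtype.ext ?_
  refine (indicator_add _ _ _).symm.trans (congrArg _ ?_)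
  funext x
  exact (add_mul _ _ _).symm

theorem smul (c : ℂ) (h : IsRegularization μ ha φ M) :
    IsRegularization μ ha (c • φ) (fun s => c * M s) := by
  obtain ⟨hM, σ, hσ⟩ := h
  refine ⟨(Meromorphic.const c).mul hM, σ, fun s hs K hK => ?_⟩
  refine ((hσ s hs K hK).const_mul c).congr fun n => ?_
  rw [← smul_eq_mul, ← map_smul]
  congr 1
  refine Subtype.ext ?_
  refine (indicator_const_smul (K n : Set U) c _).symm.trans (congrArg _ ?_)
  funext x
  exact (mul_assoc _ _ _).symm

theorem eventuallyEq [PrespectralSpace U] [SecondCountableTopology U]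
    (h : IsRegularization μ ha φ M) (h' : IsRegularization μ ha φ M') (z : ℂ) :
    M =ᶠ[𝓝[≠] z] M' := by
  obtain ⟨hM, σ, hσ⟩ := h
  obtain ⟨hM', σ', hσ'⟩ := h'
  obtain ⟨K, hK⟩ := exists_isExhaustion U
  exact hM.eventuallyEq_of_forall_lt_re hM' (σ := max σ σ') (fun s hs => tendsto_nhds_unique
    (hσ s ((le_max_left _ _).trans_lt hs) K hK) (hσ' s ((le_max_right _ _).trans_lt hs) K hK)) z

/-- Translating by `g` replaces the exhaustion `K n` by `g⁻¹ K n`, which is why regularizations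
quantify over all exhaustions; the factor `c ^ s` comes from `a`. -/
theorem translate [ContinuousConstSMul Γ T] {χ : Γ →* ℂˣ} (hμ : IsSemiInvariant χ μ) (h : IsRegularization μ ha φ M)
    (hpos : ∀ x, 0 < a x) {g : Γ} {c : ℝ} (hc : 0 < c) (hac : ∀ x, a (g • x) = c * a x) :
    IsRegularization μ ha (SchwartzFun.translate g φ) (fun s => (χ g : ℂ) * ((c : ℂ) ^ s * M s)) := by
  obtain ⟨hM, σ, hσ⟩ := h
  have hc0 : (c : ℂ) ≠ 0 := Complex.ofReal_ne_zero.2 hc.ne'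
  have hcpow : Meromorphic fun s : ℂ => (c : ℂ) ^ s := fun z =>
    (Differentiable.analyticAt (fun s => (differentiableAt_id.const_cpow (.inl hc0))) z).meromorphicAt
  refine ⟨(Meromorphic.const _).mul (hcpow.mul hM), σ, fun s hs K hK => ?_⟩
  let e : U ≃ₜ U := Homeomorph.smul g
  let L : ℕ → CompactOpens U := fun n =>
    ⟨⟨e ⁻¹' (K n), e.isCompact_preimage.2 (K n).isCompact⟩, (K n).isOpen.preimage e.continuous⟩
  have hL : IsExhaustion L := by
    refine ⟨fun i j hij => preimage_mono (f := e) (show (K i : Set U) ⊆ K j from hK.monotone hij), ?_⟩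
    change ⋃ n, e ⁻¹' (K n) = univ
    rw [← preimage_iUnion, hK.iUnion_eq, preimage_univ]
  refine (((hσ s hs L hL).const_mul ((c : ℂ) ^ s)).const_mul (χ g : ℂ)).congr fun n => ?_
  rw [← smul_eq_mul ((c : ℂ) ^ s), ← map_smul, ← hμ]
  congr 1
  refine Subtype.ext (funext fun x => ?_)
  change (c : ℂ) ^ s * (e ⁻¹' (K n)).indicator (fun y : U => (φ : T → ℂ) y * (a y : ℂ) ^ s) (g⁻¹ • x) =
    (K n : Set U).indicator (fun y : U => (φ : T → ℂ) (g⁻¹ • (y : T)) * (a y : ℂ) ^ s) x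
  have hmem : g⁻¹ • x ∈ e ⁻¹' (K n) ↔ x ∈ (K n : Set U) := by
    change g • g⁻¹ • x ∈ (K n : Set U) ↔ _
    rw [smul_inv_smul]
  by_cases hx : x ∈ (K n : Set U)
  · rw [indicator_of_mem hx, indicator_of_mem (hmem.2 hx)]
    have hax : a x = c * a (g⁻¹ • x) := by rw [← hac, smul_inv_smul]
    have hcp : ((a x : ℝ) : ℂ) ^ s = (c : ℂ) ^ s * ((a (g⁻¹ • x) : ℝ) : ℂ) ^ s := by
      rw [hax, Complex.ofReal_mul, Complex.mul_cpow_ofReal_nonneg hc.le (hpos _).le]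
    rw [hcp]
    change (c : ℂ) ^ s * ((φ : T → ℂ) (g⁻¹ • (x : T)) * _) =
      (φ : T → ℂ) (g⁻¹ • (x : T)) * ((c : ℂ) ^ s * _)
    ring
  · rw [indicator_of_notMem hx, indicator_of_notMem (fun h => hx (hmem.1 h)), mul_zero]

/-- On the compact support of `φ` the locally constant `a` has finitely many values `v`, and the
regularization is a finite sum of terms `v ^ s` with constant coefficients. -/
theorem exists_analyticAt (hpos : ∀ x, 0 < a x)
    (hφ : ∀ x ∉ U, (φ : T → ℂ) x = 0) :
    ∃ E : ℂ → ℂ, AnalyticAt ℂ E 0 ∧ IsRegularization μ ha φ E := by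
  have hsub : Function.support (φ : T → ℂ) ⊆ U := fun x hx => by_contra fun h => hx (hφ x h)
  let C : CompactOpens U := ⟨⟨Subtype.val ⁻¹' Function.support (φ : T → ℂ),
    (IsInducing.subtypeVal.isCompact_preimage_iff (by rw [Subtype.range_coe]; exact hsub)).2
      (SchwartzFun.isCompact_support φ)⟩,
    (SchwartzFun.isClopen_support φ).isOpen.preimage continuous_subtype_val⟩
  have hfin : (a '' (C : Set U)).Finite := by
    have : CompactSpace (C : Set U) := isCompact_iff_compactSpace.1 C.isCompact
    have := (ha.comp_continuous (continuous_subtype_val (p := (· ∈ (C : Set U))))).range_finite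
    rwa [range_comp, Subtype.range_coe] at this
  have hlev : ∀ v : ℝ, IsClopen (a ⁻¹' {v}) := fun v => ha.isClopen_fiber v
  let φU : SchwartzFun U := SchwartzFun.cutoff _ (φ.2.1.comp_continuous continuous_subtype_val) C
  let E : ℂ → ℂ := fun s => ∑ v ∈ hfin.toFinset, (v : ℂ) ^ s * μ (SchwartzFun.restr _ (hlev v) φU)
  have hE : Differentiable ℂ E := by
    refine Differentiable.fun_sum fun v hv => ?_
    obtain ⟨x, -, rfl⟩ := hfin.mem_toFinset.1 hv
    exact fun s => (differentiableAt_id.const_cpow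
      (.inl (Complex.ofReal_ne_zero.2 (hpos x).ne'))).mul_const _
  refine ⟨E, hE.analyticAt 0, fun z => (hE.analyticAt z).meromorphicAt, 0, fun s _ K hK => ?_⟩
  -- The truncations stabilize as soon as `K n` contains the support, so `E` is the limit for every
  -- `s`.
  refine tendsto_const_nhds.congr' ?_
  filter_upwards [hK.eventually_subset C.isCompact] with n hn
  simp only [E]
  simp_rw [← smul_eq_mul (_ ^ s), ← map_smul μ]
  rw [← map_sum]
  congr 1
  refine Subtype.ext (funext fun x => ?_)
  rw [Submodule.coe_sum, Finset.sum_apply]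
  change ∑ v ∈ hfin.toFinset, (v : ℂ) ^ s * (a ⁻¹' {v}).indicator
    ((C : Set U).indicator fun x : U => (φ : T → ℂ) x) x = (K n : Set U).indicator
    (fun y : U => (φ : T → ℂ) y * (a y : ℂ) ^ s) x
  by_cases hx : x ∈ (C : Set U)
  · rw [indicator_of_mem (hn hx), Finset.sum_eq_single (a x)]
    · rw [indicator_of_mem (by simp), indicator_of_mem hx, mul_comm]
    · intro v _ hv
      rw [indicator_of_notMem (fun h => hv h.symm), mul_zero]
    · intro h
      exact absurd (hfin.mem_toFinset.2 ⟨x, hx, rfl⟩) h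
  · have h0 : (φ : T → ℂ) x = 0 := by_contra fun h => hx h
    rw [Finset.sum_eq_zero]
    · by_cases hxK : x ∈ (K n : Set U)
      · rw [indicator_of_mem hxK, h0, zero_mul]
      · rw [indicator_of_notMem hxK]
    · intro v _
      rw [indicator_indicator, indicator_of_notMem (fun h => hx h.2), mul_zero]

end IsRegularization

/-- The leading coefficient at `s = 0` of the family of regularizations is a `χ`-invariant
distribution supported off `U`. -/
theorem IsRegularization.exists_isSemiInvariant [ContinuousConstSMul Γ T] [PrespectralSpace T] [SecondCountableTopology T]
    (hU : IsOpen (U : Set T)) {χ : Γ →* ℂˣ} {μ : LDistribution U} (hμ : IsSemiInvariant χ μ)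
    {a : U → ℝ} (ha : IsLocallyConstant a) (hpos : ∀ x, 0 < a x)
    (hac : ∀ g : Γ, ∃ c : ℝ, 0 < c ∧ ∀ x, a (g • x) = c * a x)
    (hex : ∀ φ : SchwartzFun T, ∃ M, IsRegularization μ ha φ M)
    {n₀ : ℕ} (hn₀ : ∀ φ : SchwartzFun T, ∃ M, IsRegularization μ ha φ M ∧
      ((-(n₀ : ℤ) : ℤ) : WithTop ℤ) ≤ meromorphicOrderAt M 0)
    {φ₀ : SchwartzFun T} {M₀ : ℂ → ℂ} (hM₀ : IsRegularization μ ha φ₀ M₀)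
    (hpole : meromorphicOrderAt M₀ 0 < 0) :
    ∃ ξ : LDistribution T, ξ ≠ 0 ∧ IsSemiInvariant χ ξ ∧ ∀ x ∈ ξ.supp, x ∉ U := by
  classical
  have : PrespectralSpace U := hU.isLocallyClosed.prespectralSpace
  have : SecondCountableTopology U := IsEmbedding.subtypeVal.secondCountableTopology
  choose M hM using hex
  let P : ℕ → Prop := fun n => ∀ φ, ∃ c, Tendsto (fun s => s ^ n * M φ s) (𝓝[≠] 0) (𝓝 c)
  have hmer : ∀ φ, MeromorphicAt (M φ) 0 := fun φ => (hM φ).1 0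
  have hP0 : P n₀ := by
    intro φ
    obtain ⟨M', hM', hord⟩ := hn₀ φ
    refine (tendsto_nhds_iff_meromorphicOrderAt_nonneg
      ((analyticAt_id.pow n₀).meromorphicAt.mul (hmer φ))).2 ?_
    change 0 ≤ meromorphicOrderAt (fun s => s ^ n₀ * M φ s) 0
    rw [meromorphicOrderAt_pow_mul (hmer φ), meromorphicOrderAt_congr ((hM φ).eventuallyEq hM' 0)]
    cases hk : meromorphicOrderAt M' 0 with
    | top => simp
    | coe k =>
      rw [hk] at hord
      have h3 : -(n₀ : ℤ) ≤ k := by exact_mod_cast hord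
      have h4 : (0 : ℤ) ≤ n₀ + k := by omega
      exact_mod_cast h4
  have hPex : ∃ n, P n := ⟨n₀, hP0⟩
  -- `N` is the maximal pole order over all test functions; it is positive because of `φ₀`.
  obtain ⟨N, hN, hNmin⟩ : ∃ N, P N ∧ ∀ k < N, ¬ P k :=
    ⟨Nat.find hPex, Nat.find_spec hPex, fun k hk => Nat.find_min hPex hk⟩
  have hNpos : N ≠ 0 := by
    rintro rfl
    obtain ⟨c, hc⟩ := hN φ₀
    simp only [pow_zero, one_mul] at hc
    have := (tendsto_nhds_iff_meromorphicOrderAt_nonneg (hmer φ₀)).1 ⟨c, hc⟩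
    rw [meromorphicOrderAt_congr ((hM φ₀).eventuallyEq hM₀ 0)] at this
    exact this.not_gt hpole
  choose c hc using hN
  -- The coefficient `c φ` may be computed from any regularization of `φ`, not only the chosen one.
  have key : ∀ {φ M' c'}, IsRegularization μ ha φ M' →
      Tendsto (fun s => s ^ N * M' s) (𝓝[≠] 0) (𝓝 c') → c φ = c' := by
    intro φ M' c' hM' hc'
    refine tendsto_nhds_unique (hc φ) (hc'.congr' ?_)
    filter_upwards [hM'.eventuallyEq (hM φ) 0] with s hs
    rw [hs]
  let ξ : LDistribution T :=
    { toFun := c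
      map_add' := fun φ φ' => by
        refine key ((hM φ).add (hM φ')) (((hc φ).add (hc φ')).congr fun s => ?_)
        rw [Pi.add_apply, mul_add]
      map_smul' := fun r φ => by
        refine key ((hM φ).smul r) (((hc φ).const_mul r).congr fun s => ?_)
        ring }
  refine ⟨ξ, ?_, ?_, ?_⟩
  · intro h0
    -- If all coefficients at level `k + 1` vanished, level `k` would already suffice, against
    -- minimality.
    obtain ⟨k, rfl⟩ := Nat.exists_eq_succ_of_ne_zero hNpos
    refine hNmin k k.lt_succ_self fun φ => (hmer φ).exists_tendsto_pow_mul_of_tendsto_zero ?_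
    have : c φ = 0 := LinearMap.congr_fun h0 φ
    exact this ▸ hc φ
  · intro g φ
    obtain ⟨r, hr, hra⟩ := hac g
    refine key ((hM φ).translate hμ hpos hr hra) ?_
    have hcp : Tendsto (fun s : ℂ => (r : ℂ) ^ s) (𝓝[≠] 0) (𝓝 1) := by
      have : ContinuousAt (fun s : ℂ => (r : ℂ) ^ s) 0 :=
        continuousAt_const_cpow (Complex.ofReal_ne_zero.2 hr.ne')
      have h1 := this.tendsto
      rw [Complex.cpow_zero] at h1
      exact h1.mono_left nhdsWithin_le_nhds
    have := ((hcp.mul (hc φ)).const_mul (χ g : ℂ))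
    rw [one_mul] at this
    refine this.congr fun s => ?_
    ring
  · intro x hx hxU
    obtain ⟨φ, hφ, hξφ⟩ := hx U hU hxU
    -- For `φ` supported in `U` the regularization is analytic at `0`, and `N > 0` kills it in the
    -- limit.
    obtain ⟨E, hE, hEφ⟩ := IsRegularization.exists_analyticAt (μ := μ) (ha := ha) hpos hφ
    refine hξφ (key hEφ ?_)
    have h1 : Tendsto (fun s : ℂ => s ^ N * E s) (𝓝 0) (𝓝 ((0 : ℂ) ^ N * E 0)) :=
      ((continuous_pow N).tendsto _).mul hE.continuousAt
    rw [zero_pow hNpos, zero_mul] at h1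
    exact h1.mono_left nhdsWithin_le_nhds

end Regularization

end

section

open Topology Set

/-! ### The zeta integral as a regularization -/

section ZetaResidue

/-- Invariance is assumed over the algebraic closure and descends because `F` embeds in it. -/
theorem evalPt_smul {F : Type u} [Field F] {G X : Over (Spec (.of F))} [GrpObj G] [ModObj G X]
    {ν : G ⟶ multGroup F} {f : Γ(X.left, ⊤)} (hf : IsInvariantFunction ν f) (g : RatPoints F G)
    (x : RatPoints F X) : evalPt (g • x) f = charVal ν g * evalPt x f := by
  let b : Over.mk (Spec.map (CommRingCat.ofHom (algebraMap F (AlgebraicClosure F)))) ⟶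
    Over.mk (Spec.map (CommRingCat.ofHom (algebraMap F F))) :=
      Over.homMk (Spec.map (CommRingCat.ofHom (algebraMap F (AlgebraicClosure F)))) (by simp)
  have h := hf (b ≫ g) (b ≫ x)
  have hν : charVal ν (b ≫ g) = algebraMap F (AlgebraicClosure F) (charVal ν g) := by
    unfold charVal
    rw [Category.assoc]
    exact evalPt_comp b rfl _ _
  rw [← ModObj.comp_smul, evalPt_comp b rfl, evalPt_comp b rfl, hν, ← map_mul] at h
  exact (algebraMap F (AlgebraicClosure F)).injective h

variable {F : Type u} [Field F] [ValuativeRel F] [TopologicalSpace F] [IsNonarchimedeanLocalField F]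
  {G X : Over (Spec (.of F))} [GrpObj G] [ModObj G X] {ν : G ⟶ multGroup F} {f : Γ(X.left, ⊤)}

theorem isLocallyConstant_normalizedAbs_evalPt (hf : IsInvariantFunction ν f) :
    IsLocallyConstant fun x : nonvanishingLocus hf => normalizedAbs (evalPt x.1 f) := by
  refine (IsLocallyConstant.iff_eventually_eq _).2 fun x => ?_
  have hc : Continuous fun x : nonvanishingLocus hf => evalPt x.1 f :=
    (RatPoints.continuous_evalPt f).comp continuous_subtype_val
  exact (hc.tendsto x).eventually (eventually_normalizedAbs_eq x.2)

theorem IsZetaContinuation.isRegularization [T2Space (RatPoints F X)] {hf : IsInvariantFunction ν f}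
    {μ : LDistribution (nonvanishingLocus hf)} {φ : SchwartzFun (RatPoints F X)} {M : ℂ → ℂ}
    (h : IsZetaContinuation μ φ M) :
    IsRegularization μ (isLocallyConstant_normalizedAbs_evalPt hf) φ M := by
  obtain ⟨hM, m, h, hpol, σ, hσ⟩ := h
  refine ⟨hM, σ, fun s hs K hK => ?_⟩
  rw [(hσ s hs).2]
  exact hpol.tendsto_cutoff _ (hσ s hs).1 hK

end ZetaResidue

end

end

theorem proposition3p14
    -- a non-archimedean local field of characteristic zero
    {F : Type u} [Field F] [ValuativeRel F] [TopologicalSpace F] [IsNonarchimedeanLocalField F]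
    [CharZero F]
    -- an algebraic variety over `F`
    (X : Over (Spec (.of F))) [IsReduced X.left] [IsSeparated X.hom] [LocallyOfFiniteType X.hom]
    [QuasiCompact X.hom]
    -- a connected linear algebraic group over `F` acting on it
    (G : Over (Spec (.of F))) [GrpObj G] [IsAffine G.left] [IsReduced G.left]
    [LocallyOfFiniteType G.hom] [ConnectedSpace G.left] [ModObj G X]
    -- an algebraic character `ν` and a `ν`-invariant regular function `f`
    (ν : G ⟶ multGroup F) [IsMonHom ν] (f : Γ(X.left, ⊤)) (hf : IsInvariantFunction ν f)
    -- a character `χ` of `G(F)`, continuous for the discrete topology on `ℂˣ`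
    (χ : RatPoints F G →* ℂˣ) (hχ : IsLocallyConstant χ)
    -- a `χ`-invariant distribution on the complement of the zero set of `f`
    (μ : LDistribution (nonvanishingLocus hf)) (hμ : IsSemiInvariant χ μ)
    (hstd : IsStandardAt μ 0) (hpole : HasPoleAt μ 0) :
    ∃ x : RatPoints F X, evalPt x f = 0 ∧
      IsAdmissible χ (MulAction.orbit (RatPoints F G) x) := by
  have := IsNonarchimedeanLocalField.t2Space F
  have := IsNonarchimedeanLocalField.prespectralSpace F
  have := IsNonarchimedeanLocalField.secondCountableTopology F
  have hG : CompactSpace G.left := inferInstance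
  have : QuasiCompact G.hom := (quasiCompact_iff_compactSpace G.hom).2 hG
  have := RatPoints.t2Space X
  have := RatPoints.prespectralSpace X
  have := RatPoints.secondCountableTopology X
  have := RatPoints.isTopologicalGroup G
  have := RatPoints.continuousSMul G X
  have := RatPoints.sigmaCompactSpace G
  have hU : IsOpen (nonvanishingLocus hf : Set (RatPoints F X)) :=
    isOpen_compl_singleton.preimage (RatPoints.continuous_evalPt f)
  obtain ⟨n₀, hn₀⟩ := hstd.bounded_order
  obtain ⟨φ₀, M₀, hM₀, hlt⟩ := hpole
  obtain ⟨ξ, hξ0, hξ, hsupp⟩ := IsRegularization.exists_isSemiInvariant hU hμ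
    (isLocallyConstant_normalizedAbs_evalPt hf) (fun x => normalizedAbs_pos x.2)
    -- The scaling factor of `|f|` under `g` is `|ν(g)|`.
    (fun g => ⟨normalizedAbs (charVal ν g), normalizedAbs_pos (charVal_ne_zero ν g), fun x => by
      rw [← normalizedAbs_mul, ← evalPt_smul hf]
      rfl⟩)
    (fun φ => (hstd.exists_continuation φ).imp fun M hM => hM.isRegularization)
    (fun φ => (hstd.exists_continuation φ).imp fun M hM => ⟨hM.isRegularization, hn₀ φ M hM⟩)
    hM₀.isRegularization hlt
  obtain ⟨x, hx, hadm⟩ := hξ.exists_isAdmissible_orbit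
    (fun x => RatPoints.exists_orbit_inter_eq G X x) hξ0
  exact ⟨x, not_not.1 (hsupp x hx), hadm⟩
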